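/- Let $p>1$, let $(M,g)$ be a smooth Riemannian manifold of dimension $N$ (without boundary, Hausdorff, second countable) with volume measure $dv_g$, and let $\Omega\subset M$ be an open set. For an open set $U\subset M$ let $W^{1,p}(U)$ be the completion of $\{\phi\in C^\infty(U): \int_U|\phi|^p\,dv_g+\int_U|\nabla\phi|^p\,dv_g<\infty\}$ with respect to the norm $\big(\int_U|\phi|^p\,dv_g+\int_U|\nabla\phi|^p\,dv_g\big)^{1/p}$, and let $\rho\in W^{1,p}_{loc}(\Omega)$ mean that $\rho\in W^{1,p}(U)$ for every open $U$ whose closure is compact and contained in $\Omega$; $\nabla\rho$ denotes the weak gradient, i.e. the $L^p_{loc}$ limit of the gradients of the approximating smooth functions. Let $\rho\in W^{1,p}_{loc}(\Omega)$ be nonnegative (almost everywhere) on $\Omega$ and such that $-\Delta_p\rho\ge 0$ on $\Omega$ in the weak sense, that is, $$\int_\Omega |\nabla\rho|^{p-2}\,\nabla\rho\cdot\nabla\varphi\,dv_g\ \ge\ 0\qquad\text{for every nonnegative }\varphi\in C^1_0(\Omega),$$ where $C^1_0(\Omega)$ and $C^\infty_0(\Omega)$ are the spaces of $C^1$ and $C^\infty$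 functions with compact support in $\Omega$. Read the quotient $|\nabla\rho|^p/\rho^p$ as a function with values in $[0,\infty]$, equal to $0$ where $\rho=0$ and $\nabla\rho=0$, and to $\infty$ where $\rho=0$ and $\nabla\rho\ne0$. Then $\dfrac{|\nabla\rho|^p}{\rho^p}\in L^1_{loc}(\Omega)$, and $$\Big(\frac{p-1}{p}\Big)^p\int_\Omega \frac{|u|^p}{\rho^p}\,|\nabla\rho|^p\,dv_g\ \le\ \int_\Omega|\nabla u|^p\,dv_g\qquad\text{for every }u\in C^\infty_0(\Omega).$$ -/

import Mathlib

open MeasureTheory Set Filter Topology Manifold Bundle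
open scoped ENNReal ContDiff

noncomputable section

namespace RiemannianHardy

section Volume

variable {n : ℕ} {M : Type*} [TopologicalSpace M] [ChartedSpace (EuclideanSpace ℝ (Fin n)) M]

/-- The coordinate vector field `∂ᵢ` of the chart `e`, at the point of `M` with coordinates `y`. -/
def coordVector (e : OpenPartialHomeomorph M (EuclideanSpace ℝ (Fin n)))
    (y : EuclideanSpace ℝ (Fin n)) (i : Fin n) : TangentSpace (𝓡 n) (e.symm y) :=
  mfderiv (𝓡 n) (𝓡 n) e.symm y
    (EuclideanSpace.single i (1 : ℝ) : EuclideanSpace ℝ (Fin n))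

variable [RiemannianBundle (fun x : M ↦ TangentSpace (𝓡 n) x)]

/-- The volume density `√(det (gᵢⱼ))` in the chart `e`, where `gᵢⱼ = ⟪∂ᵢ, ∂ⱼ⟫`. -/
def volumeDensity (e : OpenPartialHomeomorph M (EuclideanSpace ℝ (Fin n)))
    (y : EuclideanSpace ℝ (Fin n)) : ℝ :=
  Real.sqrt (Matrix.gram ℝ (coordVector e y)).det

variable [MeasurableSpace M]

/-- The Riemannian volume of the domain of the chart `e`, as a measure on `M` carried by this
domain: the image of `√(det (gᵢⱼ)) dy` under the inverse of the chart. -/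
def chartVolume (e : OpenPartialHomeomorph M (EuclideanSpace ℝ (Fin n))) : Measure M :=
  ((volume.restrict e.target).withDensity fun y ↦ ENNReal.ofReal (volumeDensity e y)).map e.symm

variable (n M) in
/-- The Riemannian volume measure `dv_g`. The measures `chartVolume e` agree on the overlaps of the
charts, so their supremum is the measure on `M` that restricts to `chartVolume e` on the domain of
each chart `e`. -/
def riemannianVolume : Measure M :=
  ⨆ e ∈ atlas (EuclideanSpace ℝ (Fin n)) M, chartVolume e

end Volume

section Sobolev

variable {n : ℕ} {M : Type*} [TopologicalSpace M] [ChartedSpace (EuclideanSpace ℝ (Fin n)) M]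
  [RiemannianBundle (fun x : M ↦ TangentSpace (𝓡 n) x)]

/-- The Riemannian gradient `∇u` of a differentiable function: `⟪∇u, v⟫ = du(v)`. -/
def grad (u : M → ℝ) (x : M) : TangentSpace (𝓡 n) x :=
  haveI : FiniteDimensional ℝ (TangentSpace (𝓡 n) x) :=
    inferInstanceAs (FiniteDimensional ℝ (EuclideanSpace ℝ (Fin n)))
  haveI : CompleteSpace (TangentSpace (𝓡 n) x) := FiniteDimensional.complete ℝ _
  (InnerProductSpace.toDual ℝ (TangentSpace (𝓡 n) x)).symm (mfderiv (𝓡 n) 𝓘(ℝ, ℝ) u x)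

variable [MeasurableSpace M]

/-- `-Δ_p ρ ≥ 0` on `Ω` in the weak sense, for a function `ρ` with weak gradient `V`:
`∫_Ω |∇ρ|^{p-2} ∇ρ · ∇φ ≥ 0` for all nonnegative `φ ∈ C^1_0(Ω)`. For `p < 2` the vector
`|∇ρ|^{p-2} ∇ρ` is `0` where `∇ρ = 0`. -/
def IsWeaklyPSuperharmonicOn (p : ℝ) (Ω : Set M) (V : ∀ x : M, TangentSpace (𝓡 n) x) : Prop :=
  ∀ φ : M → ℝ, ContMDiff (𝓡 n) 𝓘(ℝ, ℝ) 1 φ → HasCompactSupport φ → tsupport φ ⊆ Ω →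
    (∀ x, 0 ≤ φ x) →
    0 ≤ ∫ x in Ω, ‖V x‖ ^ (p - 2) * inner ℝ (V x) (grad φ x) ∂(riemannianVolume n M)

variable [IsManifold (𝓡 n) ∞ M]

/-- `ρ ∈ W^{1,p}(U)` with weak gradient `V`, where `W^{1,p}(U)` is the completion of the space of
the smooth functions `φ` on `U` with `∫_U |φ|^p + ∫_U |∇φ|^p < ∞`, for the norm
`(∫_U |φ|^p + ∫_U |∇φ|^p)^{1/p}`: the pair `(ρ, V)` is the limit of such pairs `(φ, ∇φ)`. -/
structure HasSobolevGradOn (p : ℝ) (U : Set M) (ρ : M → ℝ)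
    (V : ∀ x : M, TangentSpace (𝓡 n) x) : Prop where
  aestronglyMeasurable : AEStronglyMeasurable ρ ((riemannianVolume n M).restrict U)
  aestronglyMeasurable_grad : AEStronglyMeasurable
    (fun x ↦ (⟨x, V x⟩ : TangentBundle (𝓡 n) M)) ((riemannianVolume n M).restrict U)
  exists_approx : ∃ φ : ℕ → M → ℝ,
    (∀ k, ContMDiffOn (𝓡 n) 𝓘(ℝ, ℝ) ∞ (φ k) U) ∧
    (∀ k, ∫⁻ x in U, ‖φ k x‖ₑ ^ p ∂(riemannianVolume n M) < ⊤) ∧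
    (∀ k, ∫⁻ x in U, ‖grad (n := n) (φ k) x‖ₑ ^ p ∂(riemannianVolume n M) < ⊤) ∧
    Tendsto (fun k ↦ ∫⁻ x in U, ‖φ k x - ρ x‖ₑ ^ p ∂(riemannianVolume n M)) atTop (𝓝 0) ∧
    Tendsto (fun k ↦ ∫⁻ x in U, ‖grad (φ k) x - V x‖ₑ ^ p ∂(riemannianVolume n M)) atTop (𝓝 0)

/-- `ρ ∈ W^{1,p}_loc(Ω)` with weak gradient `V`: for every open set `U` whose closure is compact
and contained in `Ω`, `ρ ∈ W^{1,p}(U)` with weak gradient `V`. -/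
def HasLocSobolevGradOn (p : ℝ) (Ω : Set M) (ρ : M → ℝ)
    (V : ∀ x : M, TangentSpace (𝓡 n) x) : Prop :=
  ∀ U : Set M, IsOpen U → IsCompact (closure U) → closure U ⊆ Ω → HasSobolevGradOn p U ρ V

end Sobolev

end RiemannianHardy

end

/-! Formally, test the weak inequality with `|u|^p ρ^(1-p)`. Its gradient is `p |u|^(p-2) u ρ^(1-p)
∇u - (p-1) |u|^p ρ^(-p) ∇ρ`. With `X = |u| |∇ρ| / ρ` this gives `(p-1) ∫ X^p ≤ p ∫ X^(p-1) |∇u|`.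
Young's inequality, weighted by `c = (p-1)/p`, absorbs part of the right side and leaves `c ∫ X^p ≤
c^(1-p) ∫ |∇u|^p`, which is the claim after multiplication by `c^(p-1)` (`hardy_integrand_le`,
`lintegral_shifted_le`).

Two obstacles make this formal. First, `ρ` may vanish, so it is replaced by `ρ + ε`; Fatou's lemma
removes `ε` at the end (`lintegral_le_of_forall_shifted_le`). Second, `ρ` is only a Sobolev
function, so the test function uses smooth approximations `φ k`, while the field `|∇ρ|^(p-2) ∇ρ`
stays fixed. The `φ k` may be negative although `ρ` is not; hence `t ↦ (t + ε)^(1-p)` is continued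
affinely to `t ≤ 0`, which keeps it `C^1`, positive and Lipschitz. The limit in `k` is
`integral_nonneg_of_tendsto`.

Local integrability of the weight follows from the inequality itself, with a bump function for `u`.
Of the volume measure, the argument uses only that it is a locally finite Borel measure. -/

namespace RiemannianHardy

/-! ### Riemannian volume in charts and its local finiteness. -/

/-- Change of variables for Gram determinants of the images of the standard basis. -/
theorem det_gram_comp {n : ℕ} {E : Type*} [NormedAddCommGroup E] [InnerProductSpace ℝ E]
    (T : EuclideanSpace ℝ (Fin n) →ₗ[ℝ] E)
    (B : EuclideanSpace ℝ (Fin n) →L[ℝ] EuclideanSpace ℝ (Fin n)) :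
    (Matrix.gram ℝ fun i ↦ T (B (EuclideanSpace.single i 1))).det =
      B.det ^ 2 * (Matrix.gram ℝ fun i ↦ T (EuclideanSpace.single i 1)).det := by
  set b := (EuclideanSpace.basisFun (Fin n) ℝ).toBasis with hb
  set A := LinearMap.toMatrix b b (B : _ →ₗ[ℝ] _) with hA
  have hAij : ∀ i j, A i j = B (EuclideanSpace.single j 1) i := fun i j ↦ by
    simp [hA, hb, LinearMap.toMatrix_apply]
  have hB : ∀ j, B (EuclideanSpace.single j 1) =
      ∑ i, A i j • (EuclideanSpace.single i 1 : EuclideanSpace ℝ (Fin n)) := fun j ↦ by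
    ext k
    simp [hAij, Finset.sum_apply, Pi.single_apply]
  have key : (Matrix.gram ℝ fun i ↦ T (B (EuclideanSpace.single i 1))) =
      A.transpose * (Matrix.gram ℝ fun i ↦ T (EuclideanSpace.single i 1)) * A := by
    ext i j
    simp only [Matrix.gram_apply, Matrix.mul_apply, Matrix.transpose_apply, hB, map_sum, map_smul,
      sum_inner, inner_sum, inner_smul_left, inner_smul_right, Finset.sum_mul, Finset.mul_sum,
      RCLike.conj_to_real]
    exact Finset.sum_congr rfl fun k _ ↦ Finset.sum_congr rfl fun l _ ↦ by ring
  have hdet : A.det = B.det := LinearMap.det_toMatrix b _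
  rw [key, Matrix.det_mul, Matrix.det_mul, Matrix.det_transpose, hdet]
  ring

/-- A smooth Riemannian metric on a manifold is continuous. -/
instance isContinuousRiemannianBundle_tangentSpace {n : ℕ} {M : Type*} [TopologicalSpace M]
    [ChartedSpace (EuclideanSpace ℝ (Fin n)) M] [IsManifold (𝓡 n) ∞ M]
    [RiemannianBundle (fun x : M ↦ TangentSpace (𝓡 n) x)]
    [h : IsContMDiffRiemannianBundle (𝓡 n) ∞ (EuclideanSpace ℝ (Fin n))
      (fun x : M ↦ TangentSpace (𝓡 n) x)] :
    IsContinuousRiemannianBundle (EuclideanSpace ℝ (Fin n))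
      (fun x : M ↦ TangentSpace (𝓡 n) x) := by
  obtain ⟨g, hg, hg'⟩ := h.exists_contMDiff
  exact ⟨g, hg.continuous, hg'⟩

theorem measurableSet_preimage_chart_symm {n : ℕ} {M : Type*} [TopologicalSpace M]
    [MeasurableSpace M] [BorelSpace M] (e : OpenPartialHomeomorph M (EuclideanSpace ℝ (Fin n)))
    {A : Set M} (hA : MeasurableSet A) : MeasurableSet (e.symm ⁻¹' A ∩ e.target) := by
  have h : Measurable (e.target.domRestrict e.symm) :=
    (continuousOn_iff_continuous_domRestrict.1 e.continuousOn_symm).measurable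
  have := e.open_target.measurableSet.subtype_image (h hA)
  convert this using 1
  ext y
  simp [and_comm]

section ChartVolume

variable {n : ℕ} {M : Type*} [TopologicalSpace M] [ChartedSpace (EuclideanSpace ℝ (Fin n)) M]
  [RiemannianBundle (fun x : M ↦ TangentSpace (𝓡 n) x)] [MeasurableSpace M] [BorelSpace M]

theorem chartVolume_apply (e : OpenPartialHomeomorph M (EuclideanSpace ℝ (Fin n)))
    {A : Set M} (hA : MeasurableSet A) :
    chartVolume e A =
      ∫⁻ y in e.symm ⁻¹' A ∩ e.target, ENNReal.ofReal (volumeDensity e y) := by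
  have hm : AEMeasurable e.symm (volume.restrict e.target) :=
    e.continuousOn_symm.aemeasurable e.open_target.measurableSet
  rw [chartVolume, Measure.map_apply_of_aemeasurable
    (hm.mono_ac (withDensity_absolutelyContinuous _ _)) hA, withDensity_apply',
    Measure.restrict_restrict' e.open_target.measurableSet]

theorem chartVolume_compl_source (e : OpenPartialHomeomorph M (EuclideanSpace ℝ (Fin n))) :
    chartVolume e e.sourceᶜ = 0 := by
  rw [chartVolume_apply e e.open_source.measurableSet.compl]
  have : e.symm ⁻¹' e.sourceᶜ ∩ e.target = ∅ := by
    ext y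
    simp only [mem_inter_iff, mem_preimage, mem_compl_iff, mem_empty_iff_false, iff_false]
    exact fun h ↦ h.1 (e.map_target h.2)
  rw [this, Measure.restrict_empty, lintegral_zero_measure]

end ChartVolume

section Volume

variable {n : ℕ} {M : Type*} [TopologicalSpace M] [ChartedSpace (EuclideanSpace ℝ (Fin n)) M]
  [IsManifold (𝓡 n) ∞ M]

theorem contMDiffOn_chart {e : OpenPartialHomeomorph M (EuclideanSpace ℝ (Fin n))}
    (he : e ∈ atlas (EuclideanSpace ℝ (Fin n)) M) : ContMDiffOn (𝓡 n) (𝓡 n) ∞ e e.source :=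
  contMDiffOn_of_mem_maximalAtlas (IsManifold.subset_maximalAtlas he)

theorem contMDiffOn_chart_symm {e : OpenPartialHomeomorph M (EuclideanSpace ℝ (Fin n))}
    (he : e ∈ atlas (EuclideanSpace ℝ (Fin n)) M) :
    ContMDiffOn (𝓡 n) (𝓡 n) ∞ e.symm e.target :=
  contMDiffOn_symm_of_mem_maximalAtlas (IsManifold.subset_maximalAtlas he)

theorem mdifferentiableAt_chart_symm {e : OpenPartialHomeomorph M (EuclideanSpace ℝ (Fin n))}
    (he : e ∈ atlas (EuclideanSpace ℝ (Fin n)) M) {y : EuclideanSpace ℝ (Fin n)}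
    (hy : y ∈ e.target) : MDifferentiableAt (𝓡 n) (𝓡 n) e.symm y :=
  ((contMDiffOn_chart_symm he).contMDiffAt (e.open_target.mem_nhds hy)).mdifferentiableAt
    (by simp)

theorem mdifferentiableAt_chart {e : OpenPartialHomeomorph M (EuclideanSpace ℝ (Fin n))}
    (he : e ∈ atlas (EuclideanSpace ℝ (Fin n)) M) {x : M}
    (hx : x ∈ e.source) : MDifferentiableAt (𝓡 n) (𝓡 n) e x :=
  ((contMDiffOn_chart he).contMDiffAt (e.open_source.mem_nhds hx)).mdifferentiableAt (by simp)

theorem differentiableAt_transition {e e' : OpenPartialHomeomorph M (EuclideanSpace ℝ (Fin n))}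
    (he : e ∈ atlas (EuclideanSpace ℝ (Fin n)) M) (he' : e' ∈ atlas (EuclideanSpace ℝ (Fin n)) M)
    {y : EuclideanSpace ℝ (Fin n)} (hy : y ∈ e.target) (hy' : e.symm y ∈ e'.source) :
    DifferentiableAt ℝ (e' ∘ e.symm) y :=
  mdifferentiableAt_iff_differentiableAt.1
    ((mdifferentiableAt_chart he' hy').comp y (mdifferentiableAt_chart_symm he hy))

variable [RiemannianBundle (fun x : M ↦ TangentSpace (𝓡 n) x)]

/-- The volume densities of two charts differ by the Jacobian of the transition map. -/
theorem volumeDensity_eq_abs_det_mul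
    {e e' : OpenPartialHomeomorph M (EuclideanSpace ℝ (Fin n))}
    (he : e ∈ atlas (EuclideanSpace ℝ (Fin n)) M) (he' : e' ∈ atlas (EuclideanSpace ℝ (Fin n)) M)
    {y : EuclideanSpace ℝ (Fin n)} (hy : y ∈ e.target) (hy' : e.symm y ∈ e'.source) :
    volumeDensity e y = |(fderiv ℝ (e' ∘ e.symm) y).det| * volumeDensity e' (e' (e.symm y)) := by
  have hd := differentiableAt_transition he he' hy hy'
  have hpt : e'.symm (e' (e.symm y)) = e.symm y := e'.left_inv hy'
  have hev : e.symm =ᶠ[𝓝 y] e'.symm ∘ (e' ∘ e.symm) := by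
    filter_upwards [(e.continuousAt_symm hy).preimage_mem_nhds (e'.open_source.mem_nhds hy')]
      with z hz
    exact (e'.left_inv hz).symm
  have hmf : ∀ v : EuclideanSpace ℝ (Fin n),
      (mfderiv (𝓡 n) (𝓡 n) e.symm y v : EuclideanSpace ℝ (Fin n)) =
        mfderiv (𝓡 n) (𝓡 n) e'.symm (e' (e.symm y)) (fderiv ℝ (e' ∘ e.symm) y v) := fun v ↦ by
    rw [hev.mfderiv_eq, mfderiv_comp y (mdifferentiableAt_chart_symm he' (e'.map_source hy'))
      (mdifferentiableAt_iff_differentiableAt.2 hd), mfderiv_eq_fderiv]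
    rfl
  -- The two base points are equal but not definitionally so; vectors of the two fibres are compared
  -- through the common model space.
  have hinner : ∀ (x x' : M) (_ : x' = x) (v w : TangentSpace (𝓡 n) x)
      (v' w' : TangentSpace (𝓡 n) x'), (v : EuclideanSpace ℝ (Fin n)) = v' →
      (w : EuclideanSpace ℝ (Fin n)) = w' → (inner ℝ v w : ℝ) = inner ℝ v' w' := by
    rintro x _ rfl v w v' w' hv hw
    congr 1
  have hgram : Matrix.gram ℝ (coordVector e y) =
      Matrix.gram ℝ fun i ↦ (mfderiv (𝓡 n) (𝓡 n) e'.symm (e' (e.symm y))).toLinearMap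
        (fderiv ℝ (e' ∘ e.symm) y (EuclideanSpace.single i 1)) := by
    ext i j
    simp only [Matrix.gram_apply, coordVector]
    exact hinner _ _ hpt _ _ _ _ (hmf _) (hmf _)
  unfold volumeDensity
  rw [hgram]
  erw [det_gram_comp]
  rw [Real.sqrt_mul (sq_nonneg _), Real.sqrt_sq_eq_abs]
  rfl

/-- The coordinate fields are images of constant sections under the tangent map of `e.symm`, hence
continuous, and the metric is continuous. -/
theorem continuousOn_volumeDensity
    [IsContMDiffRiemannianBundle (𝓡 n) ∞ (EuclideanSpace ℝ (Fin n))
      (fun x : M ↦ TangentSpace (𝓡 n) x)] {e : OpenPartialHomeomorph M (EuclideanSpace ℝ (Fin n))}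
    (he : e ∈ atlas (EuclideanSpace ℝ (Fin n)) M) :
    ContinuousOn (volumeDensity e) e.target := by
  have : IsManifold (𝓡 n) 1 M := .of_le (n := ∞) (by simp)
  have hT : ContinuousOn (tangentMapWithin (𝓡 n) (𝓡 n) e.symm e.target)
      (TotalSpace.proj ⁻¹' e.target) :=
    (contMDiffOn_chart_symm he).continuousOn_tangentMapWithin (by simp)
      e.open_target.uniqueMDiffOn
  have hv : ∀ i, ContinuousOn (fun y ↦ (⟨e.symm y, coordVector e y i⟩ : TangentBundle (𝓡 n) M))
      e.target := fun i ↦ by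
    have hsec : Continuous fun y : EuclideanSpace ℝ (Fin n) ↦
        (⟨y, (EuclideanSpace.single i (1 : ℝ) : EuclideanSpace ℝ (Fin n))⟩ :
          TangentBundle (𝓡 n) (EuclideanSpace ℝ (Fin n))) :=
      (tangentBundleModelSpaceHomeomorph (𝓡 n)).symm.continuous.comp
        (f := fun y : EuclideanSpace ℝ (Fin n) ↦
          ((y, EuclideanSpace.single i (1 : ℝ)) : ModelProd _ _)) (by fun_prop)
    refine (hT.comp hsec.continuousOn (fun y hy ↦ hy)).congr fun y hy ↦ ?_
    simp only [Function.comp, tangentMapWithin, coordVector]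
    rw [mfderivWithin_of_isOpen e.open_target hy]
  unfold volumeDensity
  refine Real.continuous_sqrt.comp_continuousOn ?_
  refine (continuous_id.matrix_det).comp_continuousOn ?_
  refine continuousOn_pi.2 fun i ↦ continuousOn_pi.2 fun j ↦ ?_
  exact ContinuousOn.inner_bundle (hv i) (hv j)

variable [MeasurableSpace M] [BorelSpace M]

/-- The volumes of two charts agree on the overlap of their domains. -/
theorem chartVolume_eq_of_subset_source
    {e e' : OpenPartialHomeomorph M (EuclideanSpace ℝ (Fin n))}
    (he : e ∈ atlas (EuclideanSpace ℝ (Fin n)) M) (he' : e' ∈ atlas (EuclideanSpace ℝ (Fin n)) M)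
    {A : Set M} (hA : MeasurableSet A) (hAe : A ⊆ e.source) (hAe' : A ⊆ e'.source) :
    chartVolume e A = chartVolume e' A := by
  rw [chartVolume_apply e hA, chartVolume_apply e' hA]
  set S := e.symm ⁻¹' A ∩ e.target
  have himg : e'.symm ⁻¹' A ∩ e'.target = (e' ∘ e.symm) '' S := by
    ext z
    constructor
    · rintro ⟨hz, hzt⟩
      refine ⟨e (e'.symm z), ⟨?_, e.map_source (hAe hz)⟩, ?_⟩
      · simpa [mem_preimage, e.left_inv (hAe hz)] using hz
      · simp [e.left_inv (hAe hz), e'.right_inv hzt]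
    · rintro ⟨y, ⟨hy, hyt⟩, rfl⟩
      exact ⟨by simpa [e'.left_inv (hAe' hy)] using hy, e'.map_source (hAe' hy)⟩
  have hinj : InjOn (e' ∘ e.symm) S := fun y hy z hz h ↦
    e.symm.injOn hy.2 hz.2 (e'.injOn (hAe' hy.1) (hAe' hz.1) h)
  rw [himg, lintegral_image_eq_lintegral_abs_det_fderiv_mul volume
    (measurableSet_preimage_chart_symm e hA)
    (fun y hy ↦ (differentiableAt_transition he he' hy.2
      (hAe' hy.1)).hasFDerivAt.hasFDerivWithinAt) hinj]
  refine setLIntegral_congr_fun (measurableSet_preimage_chart_symm e hA) fun y hy ↦ ?_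
  rw [volumeDensity_eq_abs_det_mul he he' hy.2 (hAe' hy.1), ENNReal.ofReal_mul (abs_nonneg _)]
  rfl

/-- On the domain of a chart, the Riemannian volume is at most the volume of the chart. -/
theorem riemannianVolume_le_chartVolume
    {e : OpenPartialHomeomorph M (EuclideanSpace ℝ (Fin n))}
    (he : e ∈ atlas (EuclideanSpace ℝ (Fin n)) M) {A : Set M} (hA : MeasurableSet A)
    (hAe : A ⊆ e.source) : riemannianVolume n M A ≤ chartVolume e A := by
  have hs := e.open_source.measurableSet
  -- A supremum is bounded by bounding each member. Inside `e.source`, the measure of another chart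
  -- agrees with that of `e` on the overlap and vanishes off its own domain; outside, it is at most
  -- the supremum itself.
  have hle : riemannianVolume n M ≤
      chartVolume e + (riemannianVolume n M).restrict e.sourceᶜ := by
    refine iSup₂_le fun e' he' ↦ Measure.le_iff.2 fun B hB ↦ ?_
    rw [Measure.add_apply, Measure.restrict_apply hB, ← measure_inter_add_sdiff B hs]
    gcongr ?_ + ?_
    · have h0 : chartVolume e' ((B ∩ e.source) \ e'.source) = 0 :=
        measure_mono_null (fun x hx ↦ hx.2) (chartVolume_compl_source e')
      rw [← measure_inter_add_sdiff (B ∩ e.source) e'.open_source.measurableSet, h0, add_zero,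
        chartVolume_eq_of_subset_source he' he ((hB.inter hs).inter e'.open_source.measurableSet)
          inter_subset_right (inter_subset_left.trans inter_subset_right)]
      exact measure_mono (inter_subset_left.trans inter_subset_left)
    · exact Measure.le_iff'.1 (le_iSup₂ (f := fun e _ ↦ chartVolume e) e' he') _
  refine (hle A).trans ?_
  have : A ∩ e.sourceᶜ = ∅ := by
    rw [← sdiff_eq]; exact sdiff_eq_empty.2 hAe
  simp [Measure.restrict_apply hA, this]

variable [IsContMDiffRiemannianBundle (𝓡 n) ∞ (EuclideanSpace ℝ (Fin n))
  (fun x : M ↦ TangentSpace (𝓡 n) x)]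

/-- The Riemannian volume is locally finite. -/
instance isLocallyFiniteMeasure_riemannianVolume :
    IsLocallyFiniteMeasure (riemannianVolume n M) := by
  refine ⟨fun x ↦ ?_⟩
  have : LocallyCompactSpace M := ChartedSpace.locallyCompactSpace (EuclideanSpace ℝ (Fin n)) M
  set e := chartAt (EuclideanSpace ℝ (Fin n)) x
  have he : e ∈ atlas (EuclideanSpace ℝ (Fin n)) M := chart_mem_atlas _ x
  obtain ⟨K, hK, hKe, hKc⟩ := local_compact_nhds (e.open_source.mem_nhds (mem_chart_source _ x))
  obtain ⟨W, hWK, hW, hxW⟩ := mem_nhds_iff.1 hK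
  refine ⟨W, hW.mem_nhds hxW, ?_⟩
  refine (riemannianVolume_le_chartVolume he hW.measurableSet (hWK.trans hKe)).trans_lt ?_
  rw [chartVolume_apply e hW.measurableSet]
  have hsub : e.symm ⁻¹' W ∩ e.target ⊆ e '' K := fun y hy ↦
    ⟨e.symm y, hWK hy.1, e.right_inv hy.2⟩
  have hc : IsCompact (e '' K) := hKc.image_of_continuousOn (e.continuousOn.mono hKe)
  -- Finiteness comes from a continuous density on a compact coordinate set.
  have hf_int : IntegrableOn (volumeDensity e) (e '' K) volume :=
    ((continuousOn_volumeDensity he).mono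
      (image_subset_iff.2 fun z hz ↦ e.map_source (hKe hz))).integrableOn_compact hc
  refine (lintegral_mono_set hsub).trans_lt ?_
  exact (lintegral_ofReal_le_lintegral_enorm _).trans_lt hf_int.2

end Volume

/-! ### Continuity of norms, differentials and gradients. -/

/-- On a Riemannian vector bundle of finite rank, the norm of a continuous field of linear forms on
the fibers is continuous. -/
theorem continuous_norm_linearForm {B F : Type*} {E : B → Type*} [TopologicalSpace B]
    [NormedAddCommGroup F] [NormedSpace ℝ F] [FiniteDimensional ℝ F]
    [TopologicalSpace (TotalSpace F E)] [∀ x, NormedAddCommGroup (E x)]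
    [∀ x, InnerProductSpace ℝ (E x)] [FiberBundle F E] [VectorBundle ℝ F E]
    [IsContinuousRiemannianBundle F E] {ℓ : ∀ x, E x →L[ℝ] ℝ}
    (hℓ : Continuous fun v : TotalSpace F E ↦ ℓ v.1 v.2) : Continuous fun x ↦ ‖ℓ x‖ := by
  refine continuous_iff_continuousAt.2 fun x ↦ ?_
  set T := trivializationAt F E x
  have hxT : x ∈ T.baseSet := FiberBundle.mem_baseSet_trivializationAt' x
  have hLA : ∀ y ∈ T.baseSet, ∀ v : E y, T.symmL ℝ y (T.continuousLinearMapAt ℝ y v) = v :=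
    fun y hy v ↦ T.symmL_continuousLinearMapAt hy v
  have hAL : ∀ y ∈ T.baseSet, ∀ v : F, T.continuousLinearMapAt ℝ y (T.symmL ℝ y v) = v :=
    fun y hy v ↦ T.continuousLinearMapAt_symmL hy v
  -- The form read in the trivialization. As `F` has finite dimension, pointwise continuity of these
  -- forms is continuity in norm.
  let c : B → F →L[ℝ] ℝ := fun y ↦ (ℓ y).comp (T.symmL ℝ y)
  have hc : ContinuousAt c x := by
    have hcw : ∀ w : F, ContinuousOn (fun y ↦ c y w) T.baseSet := fun w ↦
      (hℓ.comp_continuousOn (T.continuousOn_symm.comp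
        (Continuous.prodMk_left w).continuousOn fun y hy ↦ ⟨hy, mem_univ _⟩)).congr
        fun y hy ↦ by simp [c, T.symmL_apply, hy]
    exact (continuousOn_clm_apply.2 hcw).continuousAt (T.open_baseSet.mem_nhds hxT)
  -- The form transported to the fixed fibre over `x`. The transport is nearly isometric close to
  -- `x`, so `m y` and `‖ℓ y‖` differ by a factor at most `r`, for any `r > 1`.
  let m : B → ℝ := fun y ↦ ‖(c y).comp (T.continuousLinearMapAt ℝ x)‖
  have hm : ContinuousAt m x := (hc.clm_comp continuousAt_const).norm
  have hmx : m x = ‖ℓ x‖ := by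
    have h : (c x).comp (T.continuousLinearMapAt ℝ x) = ℓ x :=
      ContinuousLinearMap.ext fun v ↦ congrArg (ℓ x) (hLA x hxT v)
    exact congrArg norm h
  have hlow : ∀ r > 1, ∀ᶠ y in 𝓝 x, m y ≤ ‖ℓ y‖ * r := fun r hr ↦ by
    filter_upwards [eventually_norm_symmL_trivializationAt_comp_self_lt F E x hr] with y hy
    calc m y ≤ ‖ℓ y‖ * ‖(T.symmL ℝ y).comp (T.continuousLinearMapAt ℝ x)‖ :=
          ContinuousLinearMap.opNorm_comp_le (ℓ y)
            ((T.symmL ℝ y).comp (T.continuousLinearMapAt ℝ x))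
      _ ≤ ‖ℓ y‖ * r := by gcongr
  have hup : ∀ r > 1, ∀ᶠ y in 𝓝 x, ‖ℓ y‖ ≤ m y * r := fun r hr ↦ by
    filter_upwards [eventually_norm_symmL_trivializationAt_self_comp_lt F E x hr,
      T.open_baseSet.mem_nhds hxT] with y hy hyT
    have heq : ℓ y = ((c y).comp (T.continuousLinearMapAt ℝ x)).comp
        ((T.symmL ℝ x).comp (T.continuousLinearMapAt ℝ y)) := by
      ext v
      change _ = ℓ y (T.symmL ℝ y (T.continuousLinearMapAt ℝ x
        (T.symmL ℝ x (T.continuousLinearMapAt ℝ y v))))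
      rw [hAL x hxT, hLA y hyT]
    calc ‖ℓ y‖ ≤ m y * ‖(T.symmL ℝ x).comp (T.continuousLinearMapAt ℝ y)‖ := by
          conv_lhs => rw [heq]
          exact ContinuousLinearMap.opNorm_comp_le _ _
      _ ≤ m y * r := by
          have : 0 ≤ m y := norm_nonneg _
          gcongr
  refine tendsto_order.2 ⟨fun a ha ↦ ?_, fun a ha ↦ ?_⟩
  · obtain ⟨r, hr, har⟩ : ∃ r > 1, a * r < m x := by
      have : Tendsto (fun r : ℝ ↦ a * r) (𝓝[>] 1) (𝓝 (a * 1)) :=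
        ((continuous_const.mul continuous_id).tendsto _).mono_left nhdsWithin_le_nhds
      obtain ⟨r, h1, h2⟩ := ((this.eventually_lt_const (u := m x) (by rw [hmx]; simpa)).and
        self_mem_nhdsWithin).exists
      exact ⟨r, h2, h1⟩
    filter_upwards [hlow r hr, hm.eventually_const_lt har] with y h1 h2
    exact lt_of_mul_lt_mul_right (h2.trans_le h1) (by linarith)
  · obtain ⟨r, hr, har⟩ : ∃ r > 1, m x * r < a := by
      have : Tendsto (fun r : ℝ ↦ m x * r) (𝓝[>] 1) (𝓝 (m x * 1)) :=
        ((continuous_const.mul continuous_id).tendsto _).mono_left nhdsWithin_le_nhds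
      obtain ⟨r, h1, h2⟩ := ((this.eventually_lt_const (u := a) (by rw [hmx]; simpa)).and
        self_mem_nhdsWithin).exists
      exact ⟨r, h2, h1⟩
    filter_upwards [hup r hr, (hm.mul_const r).eventually_lt_const har] with y h1 h2
    exact h1.trans_lt h2

section Gradient

variable {n : ℕ} {M : Type*} [TopologicalSpace M] [ChartedSpace (EuclideanSpace ℝ (Fin n)) M]

/-- The differential of a real function, as a linear form on the tangent space. -/
noncomputable def differential (u : M → ℝ) (x : M) : TangentSpace (𝓡 n) x →L[ℝ] ℝ :=
  mfderiv (𝓡 n) 𝓘(ℝ, ℝ) u x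

theorem differential_congr {u v : M → ℝ} {x : M} (h : u =ᶠ[𝓝 x] v) :
    differential (n := n) u x = differential v x :=
  h.mfderiv_eq

theorem differential_of_hasMFDerivAt {u : M → ℝ} {x : M} {ℓ : TangentSpace (𝓡 n) x →L[ℝ] ℝ}
    (h : HasMFDerivAt (𝓡 n) 𝓘(ℝ, ℝ) u x ℓ) : differential u x = ℓ :=
  h.mfderiv

theorem differential_eq_zero_of_notMem_tsupport {u : M → ℝ} {x : M} (hx : x ∉ tsupport u) :
    differential (n := n) u x = 0 :=
  (differential_congr (notMem_tsupport_iff_eventuallyEq.1 hx)).trans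
    (differential_of_hasMFDerivAt (hasMFDerivAt_const (0 : ℝ) x))

theorem differential_comp {u : M → ℝ} {f : ℝ → ℝ} {f' : ℝ} {x : M}
    (hf : HasDerivAt f f' (u x)) (hu : MDifferentiableAt (𝓡 n) 𝓘(ℝ, ℝ) u x) :
    differential (n := n) (fun y ↦ f (u y)) x = f' • differential u x := by
  refine (differential_of_hasMFDerivAt
    (hf.hasFDerivAt.hasMFDerivAt.comp x hu.hasMFDerivAt)).trans ?_
  ext v
  exact mul_comm (differential u x v) f'

theorem differential_mul {u v : M → ℝ} {x : M}
    (hu : MDifferentiableAt (𝓡 n) 𝓘(ℝ, ℝ) u x) (hv : MDifferentiableAt (𝓡 n) 𝓘(ℝ, ℝ) v x) :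
    differential (n := n) (fun y ↦ u y * v y) x =
      u x • differential v x + v x • differential u x :=
  differential_of_hasMFDerivAt (hu.hasMFDerivAt.mul hv.hasMFDerivAt)

theorem continuous_differential_apply [IsManifold (𝓡 n) ∞ M] {u : M → ℝ}
    (hu : ContMDiff (𝓡 n) 𝓘(ℝ, ℝ) 1 u) :
    Continuous fun v : TangentBundle (𝓡 n) M ↦ differential u v.1 v.2 := by
  have : IsManifold (𝓡 n) 1 M := .of_le (n := ∞) (by simp)
  have h := hu.continuous_tangentMap le_rfl
  exact continuous_snd.comp ((tangentBundleModelSpaceHomeomorph 𝓘(ℝ, ℝ)).continuous.comp h)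

variable [RiemannianBundle (fun x : M ↦ TangentSpace (𝓡 n) x)]

theorem inner_grad (u : M → ℝ) (x : M) (v : TangentSpace (𝓡 n) x) :
    inner ℝ v (grad u x) = differential u x v := by
  have : FiniteDimensional ℝ (TangentSpace (𝓡 n) x) :=
    inferInstanceAs (FiniteDimensional ℝ (EuclideanSpace ℝ (Fin n)))
  have : CompleteSpace (TangentSpace (𝓡 n) x) := FiniteDimensional.complete ℝ _
  rw [real_inner_comm]
  exact InnerProductSpace.toDual_symm_apply

/-- The gradient has the operator norm of the differential. -/
theorem norm_grad (u : M → ℝ) (x : M) :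
    ‖grad (n := n) u x‖ = ‖differential (n := n) u x‖ := by
  have : FiniteDimensional ℝ (TangentSpace (𝓡 n) x) :=
    inferInstanceAs (FiniteDimensional ℝ (EuclideanSpace ℝ (Fin n)))
  have : CompleteSpace (TangentSpace (𝓡 n) x) := FiniteDimensional.complete ℝ _
  exact (InnerProductSpace.toDual ℝ (TangentSpace (𝓡 n) x)).symm.norm_map (differential u x)

theorem grad_congr {u v : M → ℝ} {x : M} (h : u =ᶠ[𝓝 x] v) :
    grad (n := n) u x = grad v x :=
  ext_inner_left ℝ fun z ↦ by rw [inner_grad, inner_grad, differential_congr h]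

theorem grad_eq_zero_of_notMem_tsupport {u : M → ℝ} {x : M} (hx : x ∉ tsupport u) :
    grad (n := n) u x = 0 := by
  refine ext_inner_left ℝ fun z ↦ ?_
  rw [inner_grad, differential_eq_zero_of_notMem_tsupport hx, inner_zero_right]
  rfl

variable [IsManifold (𝓡 n) ∞ M] [IsContMDiffRiemannianBundle (𝓡 n) ∞ (EuclideanSpace ℝ (Fin n))
  (fun x : M ↦ TangentSpace (𝓡 n) x)]

/-- The squared norm is the metric evaluated twice on the tautological section. -/
theorem continuous_norm_tangentBundle :
    Continuous fun v : TangentBundle (𝓡 n) M ↦ ‖v.2‖ := by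
  have h : Continuous fun v : TangentBundle (𝓡 n) M ↦ (inner ℝ v.2 v.2 : ℝ) :=
    Continuous.inner_bundle (F := EuclideanSpace ℝ (Fin n))
      (E := fun x : M ↦ TangentSpace (𝓡 n) x) (v := fun v : TangentBundle (𝓡 n) M ↦ v.2)
      (w := fun v : TangentBundle (𝓡 n) M ↦ v.2) continuous_id continuous_id
  simpa only [real_inner_self_eq_norm_sq, Real.sqrt_sq (norm_nonneg _)] using h.sqrt

/-- The norm of the gradient of a `C^1` function is continuous. -/
theorem continuous_norm_grad {u : M → ℝ} (hu : ContMDiff (𝓡 n) 𝓘(ℝ, ℝ) 1 u) :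
    Continuous fun x ↦ ‖grad (n := n) u x‖ := by
  simp only [norm_grad]
  exact continuous_norm_linearForm (F := EuclideanSpace ℝ (Fin n))
    (E := fun x : M ↦ TangentSpace (𝓡 n) x) (continuous_differential_apply hu)

/-- Expanding the square leaves `‖grad u‖`, the differential and the norm of the vector, so
continuity of `grad u` as a section is not needed. -/
theorem continuous_norm_grad_sub {u : M → ℝ} (hu : ContMDiff (𝓡 n) 𝓘(ℝ, ℝ) 1 u) :
    Continuous fun v : TangentBundle (𝓡 n) M ↦ ‖grad u v.1 - v.2‖ := by
  have h : Continuous fun v : TangentBundle (𝓡 n) M ↦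
      √(‖grad (n := n) u v.1‖ ^ 2 - 2 * differential u v.1 v.2 + ‖v.2‖ ^ 2) :=
    (((((continuous_norm_grad hu).comp
      (FiberBundle.continuous_proj (EuclideanSpace ℝ (Fin n)) _)).pow 2).sub
      (continuous_const.mul (continuous_differential_apply hu))).add
      (continuous_norm_tangentBundle.pow 2)).sqrt
  refine h.congr fun v ↦ ?_
  rw [← inner_grad, real_inner_comm, ← norm_sub_sq_real, Real.sqrt_sq (norm_nonneg _)]

end Gradient

/-! ### The shifted power and its affine continuation. -/

section ShiftedPower

/-- The derivative of `shiftedPow p ε`. -/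
noncomputable def shiftedPowDeriv (p ε t : ℝ) : ℝ := -((p - 1) * (max t 0 + ε) ^ (-p))

/-- The `C^1` function that is equal to `(t + ε) ^ (1 - p)` for `0 ≤ t` and is affine for
`t ≤ 0`. -/
noncomputable def shiftedPow (p ε t : ℝ) : ℝ :=
  ε ^ (1 - p) + ∫ s in (0 : ℝ)..t, shiftedPowDeriv p ε s

variable {p ε : ℝ}

theorem continuous_shiftedPowDeriv (p : ℝ) (hε : 0 < ε) : Continuous (shiftedPowDeriv p ε) := by
  unfold shiftedPowDeriv
  refine (continuous_const.mul (Continuous.rpow_const (by fun_prop) fun t ↦ Or.inl ?_)).neg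
  positivity

theorem hasDerivAt_shiftedPow (p : ℝ) (hε : 0 < ε) (t : ℝ) :
    HasDerivAt (shiftedPow p ε) (shiftedPowDeriv p ε t) t :=
  (((continuous_shiftedPowDeriv p hε).integral_hasStrictDerivAt 0 t).hasDerivAt).const_add _

theorem contDiff_shiftedPow (p : ℝ) (hε : 0 < ε) : ContDiff ℝ 1 (shiftedPow p ε) := by
  refine contDiff_one_iff_deriv.2 ⟨fun t ↦ (hasDerivAt_shiftedPow p hε t).differentiableAt, ?_⟩
  rw [funext fun t ↦ (hasDerivAt_shiftedPow p hε t).deriv]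
  exact continuous_shiftedPowDeriv p hε

theorem shiftedPow_of_nonneg (p : ℝ) (hε : 0 < ε) {t : ℝ} (ht : 0 ≤ t) :
    shiftedPow p ε t = (t + ε) ^ (1 - p) := by
  have h : ∫ s in (0 : ℝ)..t, shiftedPowDeriv p ε s = (t + ε) ^ (1 - p) - (0 + ε) ^ (1 - p) := by
    refine intervalIntegral.integral_eq_sub_of_hasDerivAt (f := fun s ↦ (s + ε) ^ (1 - p))
      (fun s hs ↦ ?_) ((continuous_shiftedPowDeriv p hε).intervalIntegrable _ _)
    have hs0 : 0 ≤ s := by rw [uIcc_of_le ht] at hs; exact hs.1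
    have hd : HasDerivAt (fun s ↦ (s + ε) ^ (1 - p)) (1 * (1 - p) * (s + ε) ^ (1 - p - 1)) s :=
      ((hasDerivAt_id s).add_const ε).rpow_const (Or.inl (by simp only [id]; positivity))
    have heq : shiftedPowDeriv p ε s = 1 * (1 - p) * (s + ε) ^ (1 - p - 1) := by
      rw [shiftedPowDeriv, max_eq_left hs0, show 1 - p - 1 = -p by ring]
      ring
    rwa [heq]
  rw [shiftedPow, h]
  simp

theorem shiftedPowDeriv_of_nonneg (p ε : ℝ) {t : ℝ} (ht : 0 ≤ t) :
    shiftedPowDeriv p ε t = -((p - 1) * (t + ε) ^ (-p)) := by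
  rw [shiftedPowDeriv, max_eq_left ht]

theorem shiftedPowDeriv_nonpos (hp : 1 < p) (hε : 0 < ε) (t : ℝ) :
    shiftedPowDeriv p ε t ≤ 0 := by
  have : 0 ≤ p - 1 := by linarith
  rw [shiftedPowDeriv, neg_nonpos]
  positivity

theorem abs_shiftedPowDeriv_le (hp : 1 < p) (hε : 0 < ε) (t : ℝ) :
    |shiftedPowDeriv p ε t| ≤ (p - 1) * ε ^ (-p) := by
  have h1 : 0 ≤ p - 1 := by linarith
  rw [shiftedPowDeriv, abs_neg, abs_of_nonneg (by positivity)]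
  gcongr ?_ * ?_
  exact Real.rpow_le_rpow_of_nonpos hε (by simp) (by linarith)

/-- Keeps the test function nonnegative where an approximation of `ρ` is negative. -/
theorem shiftedPow_pos (hp : 1 < p) (hε : 0 < ε) (t : ℝ) : 0 < shiftedPow p ε t := by
  rcases le_total 0 t with ht | ht
  · rw [shiftedPow_of_nonneg p hε ht]; positivity
  · have hanti : Antitone (shiftedPow p ε) :=
      antitone_of_deriv_nonpos (fun s ↦ (hasDerivAt_shiftedPow p hε s).differentiableAt)
        fun s ↦ by rw [(hasDerivAt_shiftedPow p hε s).deriv]; exact shiftedPowDeriv_nonpos hp hε s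
    refine lt_of_lt_of_le ?_ (hanti ht)
    rw [shiftedPow_of_nonneg p hε le_rfl]; positivity

/-- `shiftedPow` is unbounded at `-∞`; the global Lipschitz bound replaces boundedness when
approximations take negative values. -/
theorem abs_shiftedPow_sub_le (hp : 1 < p) (hε : 0 < ε) (s t : ℝ) :
    |shiftedPow p ε s - shiftedPow p ε t| ≤ (p - 1) * ε ^ (-p) * |s - t| :=
  convex_univ.norm_image_sub_le_of_norm_hasDerivWithin_le
    (fun s _ ↦ (hasDerivAt_shiftedPow p hε s).hasDerivWithinAt)
    (fun s _ ↦ abs_shiftedPowDeriv_le hp hε s) (mem_univ t) (mem_univ s)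

end ShiftedPower

/-! ### Passage to the limit from smooth approximations. -/

section Limit

variable {X : Type*} [MeasurableSpace X] {μ : Measure X} {p : ℝ}

/-- Hölder's inequality with exponents `p / (p - 1)` and `p`. -/
theorem tendsto_lintegral_rpow_mul (hp : 1 < p) {a : X → ℝ≥0∞} {e : ℕ → X → ℝ≥0∞}
    (ha : AEMeasurable a μ) (he : ∀ k, AEMeasurable (e k) μ) (hap : ∫⁻ x, a x ^ p ∂μ ≠ ⊤)
    (hlim : Tendsto (fun k ↦ ∫⁻ x, e k x ^ p ∂μ) atTop (𝓝 0)) :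
    Tendsto (fun k ↦ ∫⁻ x, a x ^ (p - 1) * e k x ∂μ) atTop (𝓝 0) := by
  have hpq : (p / (p - 1)).HolderConjugate p := (Real.HolderConjugate.conjExponent hp).symm
  have hp1 : p - 1 ≠ 0 := by linarith
  have hle : ∀ k, ∫⁻ x, a x ^ (p - 1) * e k x ∂μ ≤
      (∫⁻ x, a x ^ p ∂μ) ^ (1 / (p / (p - 1))) * (∫⁻ x, e k x ^ p ∂μ) ^ (1 / p) := fun k ↦ by
    have := ENNReal.lintegral_mul_le_Lp_mul_Lq μ hpq (ha.pow_const (p - 1)) (he k)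
    simpa only [Pi.mul_apply, ← ENNReal.rpow_mul, mul_div_cancel₀ p hp1] using this
  refine tendsto_of_tendsto_of_tendsto_of_le_of_le tendsto_const_nhds ?_ (fun k ↦ zero_le) hle
  have h0 : Tendsto (fun k ↦ (∫⁻ x, e k x ^ p ∂μ) ^ (1 / p)) atTop (𝓝 0) := by
    have := hlim.ennrpow_const (1 / p)
    rwa [ENNReal.zero_rpow_of_pos (by positivity)] at this
  have hfin : (∫⁻ x, a x ^ p ∂μ) ^ (1 / (p / (p - 1))) ≠ ⊤ :=
    ENNReal.rpow_ne_top_of_nonneg (by have := hpq.pos; positivity) hap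
  simpa using ENNReal.Tendsto.const_mul h0 (Or.inr hfin)

theorem exists_subseq_tendsto_ae (hp : 1 < p) {r : X → ℝ} {rk : ℕ → X → ℝ}
    (hr : AEStronglyMeasurable r μ) (hrk : ∀ k, AEStronglyMeasurable (rk k) μ)
    (hlim : Tendsto (fun k ↦ ∫⁻ x, ‖rk k x - r x‖ₑ ^ p ∂μ) atTop (𝓝 0)) :
    ∃ ns : ℕ → ℕ, StrictMono ns ∧
      ∀ᵐ x ∂μ, Tendsto (fun k ↦ rk (ns k) x) atTop (𝓝 (r x)) := by
  have hp0 : 0 < p := by linarith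
  refine (tendstoInMeasure_of_tendsto_eLpNorm (p := ENNReal.ofReal p)
    (by simpa using hp0) hrk hr ?_).exists_seq_tendsto_ae
  have h := hlim.ennrpow_const (1 / p)
  rw [ENNReal.zero_rpow_of_pos (by positivity)] at h
  refine h.congr fun k ↦ ?_
  rw [eLpNorm_eq_lintegral_rpow_enorm_toReal (by simpa using hp0) ENNReal.ofReal_ne_top,
    ENNReal.toReal_ofReal hp0.le]
  rfl

theorem rpow_sub_two_mul_self (hp : 1 < p) {a : ℝ} (ha : 0 ≤ a) :
    a ^ (p - 2) * a = a ^ (p - 1) := by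
  rcases ha.eq_or_lt with rfl | ha
  · rw [mul_zero, Real.zero_rpow (by linarith)]
  · rw [← Real.rpow_add_one ha.ne']; congr 1; ring

theorem rpow_sub_two_mul_sq (hp : 1 < p) {a : ℝ} (ha : 0 ≤ a) :
    a ^ (p - 2) * a ^ 2 = a ^ p := by
  rcases ha.eq_or_lt with rfl | ha
  · rw [Real.zero_rpow (by linarith : p ≠ 0)]; simp
  · rw [← Real.rpow_natCast, ← Real.rpow_add ha]; congr 1; push_cast; ring

/-- Passage to the limit in the weak inequality tested with `U * shiftedPow p ε (rk k)`: here `a`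
stands for `|∇ρ|`, `D` for `∇ρ · ∇U`, and `bk k` for `∇ρ · ∇(rk k)`. -/
theorem integral_nonneg_of_tendsto [IsFiniteMeasure μ] {ε C : ℝ} (hp : 1 < p) (hε : 0 < ε)
    {a r D U : X → ℝ} {rk bk dk : ℕ → X → ℝ}
    (ham : AEStronglyMeasurable a μ) (hrm : AEStronglyMeasurable r μ)
    (hDm : AEStronglyMeasurable D μ) (hUm : AEStronglyMeasurable U μ)
    (hrkm : ∀ k, AEStronglyMeasurable (rk k) μ) (hbkm : ∀ k, AEStronglyMeasurable (bk k) μ)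
    (hdkm : ∀ k, AEStronglyMeasurable (dk k) μ)
    (ha : ∀ x, 0 ≤ a x) (hr : ∀ᵐ x ∂μ, 0 ≤ r x) (hD : ∀ x, |D x| ≤ C * a x)
    (hU : ∀ x, |U x| ≤ C) (hbk : ∀ k x, |bk k x - a x ^ 2| ≤ dk k x * a x)
    (hap : ∫⁻ x, ‖a x‖ₑ ^ p ∂μ ≠ ⊤)
    (hrk : Tendsto (fun k ↦ ∫⁻ x, ‖rk k x - r x‖ₑ ^ p ∂μ) atTop (𝓝 0))
    (hdk : Tendsto (fun k ↦ ∫⁻ x, ‖dk k x‖ₑ ^ p ∂μ) atTop (𝓝 0))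
    (hnonneg : ∀ k, 0 ≤ ∫ x, a x ^ (p - 2) * (shiftedPow p ε (rk k x) * D x +
      U x * shiftedPowDeriv p ε (rk k x) * bk k x) ∂μ) :
    Integrable (fun x ↦ a x ^ (p - 2) * (shiftedPow p ε (r x) * D x +
      U x * shiftedPowDeriv p ε (r x) * a x ^ 2)) μ ∧
    0 ≤ ∫ x, a x ^ (p - 2) * (shiftedPow p ε (r x) * D x +
      U x * shiftedPowDeriv p ε (r x) * a x ^ 2) ∂μ := by
  rcases isEmpty_or_nonempty X with hX | ⟨⟨x₀⟩⟩
  · exact ⟨Integrable.of_isEmpty, by simp [Measure.eq_zero_of_isEmpty μ]⟩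
  have hC : 0 ≤ C := (abs_nonneg _).trans (hU x₀)
  obtain ⟨ns, hns, hae⟩ := exists_subseq_tendsto_ae hp hrm hrkm hrk
  set L := (p - 1) * ε ^ (-p) with hL
  have hL0 : 0 ≤ L := by have : 0 ≤ p - 1 := by linarith
                         positivity
  have hsc : Continuous (shiftedPow p ε) := (contDiff_shiftedPow p hε).continuous
  have hsc' := continuous_shiftedPowDeriv p hε
  set f : X → ℝ := fun x ↦ a x ^ (p - 2) * (shiftedPow p ε (r x) * D x +
      U x * shiftedPowDeriv p ε (r x) * a x ^ 2)
  set fk : ℕ → X → ℝ := fun k x ↦ a x ^ (p - 2) * (shiftedPow p ε (rk k x) * D x +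
      U x * shiftedPowDeriv p ε (rk k x) * bk k x)
  have hapm : AEStronglyMeasurable (fun x ↦ a x ^ (p - 2)) μ :=
    (ham.aemeasurable.pow_const _).aestronglyMeasurable
  have hfm : AEStronglyMeasurable f μ :=
    hapm.mul (((hsc.comp_aestronglyMeasurable hrm).mul hDm).add
      ((hUm.mul (hsc'.comp_aestronglyMeasurable hrm)).mul (ham.pow 2)))
  have hfkm : ∀ k, AEStronglyMeasurable (fk k) μ := fun k ↦
    hapm.mul (((hsc.comp_aestronglyMeasurable (hrkm k)).mul hDm).add
      ((hUm.mul (hsc'.comp_aestronglyMeasurable (hrkm k))).mul (hbkm k)))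
  have hapint : Integrable (fun x ↦ a x ^ p) μ := by
    refine ⟨(ham.aemeasurable.pow_const _).aestronglyMeasurable, ?_⟩
    refine lt_of_eq_of_lt (lintegral_congr fun x ↦ ?_) (lt_top_iff_ne_top.2 hap)
    rw [Real.enorm_rpow_of_nonneg (ha x) (by linarith)]
  have hfint : Integrable f μ := by
    -- Since `r ≥ 0`, the factor `shiftedPow p ε (r x)` is at most `ε ^ (1 - p)`; on a finite
    -- measure space `a ^ (p - 1) ≤ 1 + a ^ p` is integrable.
    refine ((((integrable_const (1 : ℝ)).add hapint).const_mul (ε ^ (1 - p) * C)).add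
      (hapint.const_mul (C * L))).mono' hfm ?_
    filter_upwards [hr] with x hx
    have hax := ha x
    have h1 : |shiftedPow p ε (r x)| ≤ ε ^ (1 - p) := by
      rw [abs_of_pos (shiftedPow_pos hp hε _), shiftedPow_of_nonneg p hε hx]
      exact Real.rpow_le_rpow_of_nonpos hε (by linarith) (by linarith)
    have h2 := abs_shiftedPowDeriv_le hp hε (r x)
    have h3 : a x ^ (p - 1) ≤ 1 + a x ^ p := by
      rcases le_total (a x) 1 with h | h
      · have := Real.rpow_le_one hax h (by linarith : 0 ≤ p - 1)
        have : 0 ≤ a x ^ p := by positivity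
        linarith
      · have := Real.rpow_le_rpow_of_exponent_le h (by linarith : p - 1 ≤ p)
        linarith
    simp only [f, Pi.add_apply, norm_mul, Real.norm_eq_abs]
    rw [abs_of_nonneg (by positivity : 0 ≤ a x ^ (p - 2))]
    calc a x ^ (p - 2) * |shiftedPow p ε (r x) * D x + U x * shiftedPowDeriv p ε (r x) * a x ^ 2|
        ≤ a x ^ (p - 2) * (ε ^ (1 - p) * (C * a x) + C * L * a x ^ 2) := by
          gcongr
          refine (abs_add_le _ _).trans ?_
          rw [abs_mul, abs_mul, abs_mul, abs_of_nonneg (by positivity : 0 ≤ a x ^ 2)]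
          gcongr
          · exact hD x
          · exact hU x
      _ = ε ^ (1 - p) * C * (a x ^ (p - 2) * a x) + C * L * (a x ^ (p - 2) * a x ^ 2) := by ring
      _ ≤ _ := by
          rw [rpow_sub_two_mul_self hp hax, rpow_sub_two_mul_sq hp hax]
          gcongr
  -- Three errors: in the value of `shiftedPow` (Lipschitz), in the gradient of the approximation,
  -- and in `shiftedPowDeriv`.
  have hdiff : ∀ k x, ‖fk k x - f x‖ₑ ≤
      ENNReal.ofReal (C * L) * (‖a x‖ₑ ^ (p - 1) * ‖rk k x - r x‖ₑ) +
      (ENNReal.ofReal (C * L) * (‖a x‖ₑ ^ (p - 1) * ‖dk k x‖ₑ) +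
      ENNReal.ofReal C * ‖(shiftedPowDeriv p ε (rk k x) - shiftedPowDeriv p ε (r x)) *
        a x ^ p‖ₑ) := fun k x ↦ by
    have hax := ha x
    have hreal : |fk k x - f x| ≤ C * L * (a x ^ (p - 1) * |rk k x - r x|) +
        (C * L * (a x ^ (p - 1) * |dk k x|) +
        C * |(shiftedPowDeriv p ε (rk k x) - shiftedPowDeriv p ε (r x)) * a x ^ p|) := by
      have hsplit : fk k x - f x = a x ^ (p - 2) *
          ((shiftedPow p ε (rk k x) - shiftedPow p ε (r x)) * D x +
          (U x * shiftedPowDeriv p ε (rk k x) * (bk k x - a x ^ 2) +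
          U x * ((shiftedPowDeriv p ε (rk k x) - shiftedPowDeriv p ε (r x)) * a x ^ 2))) := by
        simp only [fk, f]; ring
      rw [hsplit, abs_mul, abs_of_nonneg (by positivity : 0 ≤ a x ^ (p - 2))]
      calc a x ^ (p - 2) * _ ≤ a x ^ (p - 2) * (L * |rk k x - r x| * (C * a x) +
            (C * L * (|dk k x| * a x) +
            C * (|shiftedPowDeriv p ε (rk k x) - shiftedPowDeriv p ε (r x)| * a x ^ 2))) := by
            gcongr
            refine (abs_add_le _ _).trans (add_le_add ?_ ((abs_add_le _ _).trans
              (add_le_add ?_ ?_)))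
            · rw [abs_mul]
              gcongr
              · exact abs_shiftedPow_sub_le hp hε _ _
              · exact hD x
            · rw [abs_mul, abs_mul]
              gcongr
              · exact hU x
              · exact abs_shiftedPowDeriv_le hp hε _
              · exact (hbk k x).trans (by gcongr; exact le_abs_self _)
            · rw [abs_mul, abs_mul, abs_of_nonneg (by positivity : 0 ≤ a x ^ 2)]
              gcongr
              exact hU x
        _ = C * L * (a x ^ (p - 2) * a x * |rk k x - r x|) +
            (C * L * (a x ^ (p - 2) * a x * |dk k x|) +
            C * (|shiftedPowDeriv p ε (rk k x) - shiftedPowDeriv p ε (r x)| *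
              (a x ^ (p - 2) * a x ^ 2))) := by ring
        _ = _ := by
            rw [rpow_sub_two_mul_self hp hax, rpow_sub_two_mul_sq hp hax, abs_mul,
              abs_of_nonneg (by positivity : 0 ≤ a x ^ p)]
    rw [← Real.enorm_rpow_of_nonneg hax (by linarith : 0 ≤ p - 1), ← enorm_mul, ← enorm_mul]
    simp only [Real.enorm_eq_ofReal_abs]
    rw [← ENNReal.ofReal_mul (by positivity), ← ENNReal.ofReal_mul (by positivity),
      ← ENNReal.ofReal_mul (by positivity), ← ENNReal.ofReal_add (by positivity) (by positivity),
      ← ENNReal.ofReal_add (by positivity) (by positivity)]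
    refine ENNReal.ofReal_le_ofReal (hreal.trans (le_of_eq ?_))
    rw [abs_mul (a x ^ (p - 1)), abs_mul (a x ^ (p - 1)),
      abs_of_nonneg (by positivity : 0 ≤ a x ^ (p - 1))]
  have h1 := (tendsto_lintegral_rpow_mul hp ham.enorm (fun k ↦ ((hrkm k).sub hrm).enorm)
    hap hrk).comp hns.tendsto_atTop
  have h2 := (tendsto_lintegral_rpow_mul hp ham.enorm (fun k ↦ (hdkm k).enorm)
    hap hdk).comp hns.tendsto_atTop
  -- Here the weight `a ^ p` is merely integrable and Hölder's inequality is of no use; boundedness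
  -- of the derivative and almost everywhere convergence of the subsequence allow dominated
  -- convergence.
  have h3 : Tendsto (fun k ↦ ∫⁻ x, ‖(shiftedPowDeriv p ε (rk (ns k) x) -
      shiftedPowDeriv p ε (r x)) * a x ^ p‖ₑ ∂μ) atTop (𝓝 0) := by
    have hz : ∫⁻ _, (0 : ℝ≥0∞) ∂μ = 0 := lintegral_zero
    rw [← hz]
    refine tendsto_lintegral_of_dominated_convergence' (fun x ↦ ‖2 * L * a x ^ p‖ₑ)
      (fun k ↦ ?_) (fun k ↦ ?_) ?_ ?_
    · exact ((((hsc'.comp_aestronglyMeasurable (hrkm _)).sub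
        (hsc'.comp_aestronglyMeasurable hrm))).mul hapint.1).enorm
    · refine Eventually.of_forall fun x ↦ ?_
      simp only [enorm_mul _ (a x ^ p)]
      gcongr
      refine enorm_le_iff_norm_le.2 ?_
      rw [Real.norm_eq_abs, Real.norm_of_nonneg (by positivity), two_mul]
      exact (abs_sub _ _).trans (add_le_add (abs_shiftedPowDeriv_le hp hε _)
        (abs_shiftedPowDeriv_le hp hε _))
    · exact (hapint.const_mul (2 * L)).2.ne
    · filter_upwards [hae] with x hx
      have h := (((hsc'.tendsto (r x)).comp hx).sub_const (shiftedPowDeriv p ε (r x))).mul_const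
        (a x ^ p)
      simpa using h.enorm
  have hlim : Tendsto (fun k ↦ ∫⁻ x, ‖fk (ns k) x - f x‖ₑ ∂μ) atTop (𝓝 0) := by
    have hsum := (ENNReal.Tendsto.const_mul (a := ENNReal.ofReal (C * L)) h1 (Or.inr (by simp))).add
      ((ENNReal.Tendsto.const_mul (a := ENNReal.ofReal (C * L)) h2 (Or.inr (by simp))).add
        (ENNReal.Tendsto.const_mul (a := ENNReal.ofReal C) h3 (Or.inr (by simp))))
    simp only [mul_zero, add_zero] at hsum
    refine tendsto_of_tendsto_of_tendsto_of_le_of_le tendsto_const_nhds hsum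
      (fun k ↦ zero_le) fun k ↦ (lintegral_mono fun x ↦ hdiff (ns k) x).trans (le_of_eq ?_)
    have m1 : AEMeasurable (fun x ↦ ‖a x‖ₑ ^ (p - 1) * ‖rk (ns k) x - r x‖ₑ) μ :=
      (ham.enorm.pow_const _).mul ((hrkm _).sub hrm).enorm
    have m2 : AEMeasurable (fun x ↦ ‖a x‖ₑ ^ (p - 1) * ‖dk (ns k) x‖ₑ) μ :=
      (ham.enorm.pow_const _).mul (hdkm _).enorm
    rw [lintegral_add_left' (m1.const_mul _), lintegral_add_left' (m2.const_mul _),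
      lintegral_const_mul' _ _ (by simp), lintegral_const_mul' _ _ (by simp),
      lintegral_const_mul' _ _ (by simp)]
    rfl
  refine ⟨hfint, ge_of_tendsto' (tendsto_integral_of_L1 f hfm ?_ hlim) fun k ↦ hnonneg (ns k)⟩
  filter_upwards [hlim.eventually_lt_const ENNReal.zero_lt_top] with k hk
  have hdi : Integrable (fun x ↦ fk (ns k) x - f x) μ := ⟨(hfkm _).sub hfm, hk⟩
  exact (hdi.add hfint).congr (Eventually.of_forall fun x ↦ by simp)

end Limit

/-! ### The pointwise inequality with the sharp constant. -/

section PointwiseInequality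

variable {p : ℝ}

/-- Young's inequality with the weights that give the sharp Hardy constant. -/
theorem mul_rpow_mul_le (hp : 1 < p) {X Y : ℝ} (hX : 0 ≤ X) (hY : 0 ≤ Y) :
    p * (X ^ (p - 1) * Y) ≤
      (p - 1) * ((p - 1) / p) * X ^ p + ((p - 1) / p) ^ (1 - p) * Y ^ p := by
  have hp0 : 0 < p := by linarith
  have hp1 : 0 < p - 1 := by linarith
  set c := (p - 1) / p with hc
  have hc0 : 0 < c := by positivity
  have hpq : p.HolderConjugate (p / (p - 1)) := Real.HolderConjugate.conjExponent hp
  -- The scaling factors cancel in the product; their exponents turn `X ^ (p - 1)` into `c * X ^ p`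
  -- and `Y` into `c ^ (1 - p) * Y ^ p`.
  have hY' : 0 ≤ c ^ (-((p - 1) / p)) * Y := by positivity
  have hX' : 0 ≤ c ^ ((p - 1) / p) * X ^ (p - 1) := by positivity
  have h := Real.young_inequality_of_nonneg hY' hX' hpq
  have e1 : (c ^ (-((p - 1) / p)) * Y) ^ p = c ^ (1 - p) * Y ^ p := by
    rw [Real.mul_rpow (by positivity) hY, ← Real.rpow_mul hc0.le]
    congr 2
    field_simp
    ring
  have e2 : (c ^ ((p - 1) / p) * X ^ (p - 1)) ^ (p / (p - 1)) = c * X ^ p := by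
    rw [Real.mul_rpow (by positivity) (by positivity), ← Real.rpow_mul hc0.le,
      ← Real.rpow_mul hX]
    have h1 : (p - 1) / p * (p / (p - 1)) = 1 := by field_simp
    have h2 : (p - 1) * (p / (p - 1)) = p := by field_simp
    rw [h1, h2, Real.rpow_one]
  have e3 : c ^ (-((p - 1) / p)) * Y * (c ^ ((p - 1) / p) * X ^ (p - 1)) = X ^ (p - 1) * Y := by
    rw [Real.rpow_neg hc0.le]
    have : c ^ ((p - 1) / p) ≠ 0 := by positivity
    field_simp
  rw [e1, e2, e3] at h
  calc p * (X ^ (p - 1) * Y) ≤ p * (c ^ (1 - p) * Y ^ p / p + c * X ^ p / (p / (p - 1))) := by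
        gcongr
    _ = _ := by field_simp; ring

/-- With `X = |u| a / (r + ε)`, the derivative term is exactly `-(p-1) X^p`, and Young's inequality
costs `(p-1) c X^p` with `c = (p-1)/p`. What remains is `-c X^p`, because `(p-1)(1-c) = c`. -/
theorem hardy_integrand_le (hp : 1 < p) {ε r a u y D : ℝ} (hε : 0 < ε) (hr : 0 ≤ r) (ha : 0 ≤ a)
    (hy : 0 ≤ y) (hD : |D| ≤ p * |u| ^ (p - 1) * y * a) :
    a ^ (p - 2) * (shiftedPow p ε r * D + |u| ^ p * shiftedPowDeriv p ε r * a ^ 2) ≤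
      ((p - 1) / p) ^ (1 - p) * y ^ p - (p - 1) / p * (|u| * a / (r + ε)) ^ p := by
  have hp0 : 0 < p := by linarith
  have hs : 0 < r + ε := by linarith
  have hX : 0 ≤ |u| * a / (r + ε) := by positivity
  have hyoung := mul_rpow_mul_le hp hX hy
  have hXp : (|u| * a / (r + ε)) ^ p = |u| ^ p * a ^ p * (r + ε) ^ (-p) := by
    rw [Real.div_rpow (by positivity) hs.le, Real.mul_rpow (abs_nonneg _) ha,
      Real.rpow_neg hs.le, div_eq_mul_inv]
  have hXp1 : (|u| * a / (r + ε)) ^ (p - 1) =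
      |u| ^ (p - 1) * a ^ (p - 1) * (r + ε) ^ (1 - p) := by
    rw [Real.div_rpow (by positivity) hs.le, Real.mul_rpow (abs_nonneg _) ha,
      show 1 - p = -(p - 1) by ring, Real.rpow_neg hs.le, div_eq_mul_inv]
  have hfirst : a ^ (p - 2) * (shiftedPow p ε r * D) ≤ p * ((|u| * a / (r + ε)) ^ (p - 1) * y) := by
    rw [shiftedPow_of_nonneg p hε hr, hXp1]
    calc a ^ (p - 2) * ((r + ε) ^ (1 - p) * D)
        ≤ a ^ (p - 2) * ((r + ε) ^ (1 - p) * (p * |u| ^ (p - 1) * y * a)) := by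
          gcongr
          exact (le_abs_self D).trans hD
      _ = p * (|u| ^ (p - 1) * (a ^ (p - 2) * a) * (r + ε) ^ (1 - p) * y) := by ring
      _ = _ := by rw [rpow_sub_two_mul_self hp ha]
  have hsecond : a ^ (p - 2) * (|u| ^ p * shiftedPowDeriv p ε r * a ^ 2) =
      -((p - 1) * (|u| * a / (r + ε)) ^ p) := by
    rw [shiftedPowDeriv_of_nonneg p ε hr, hXp, ← rpow_sub_two_mul_sq hp ha]
    ring
  have hcoef : (p - 1) * ((p - 1) / p) = (p - 1) - (p - 1) / p := by field_simp
  rw [hcoef] at hyoung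
  rw [mul_add, hsecond]
  linarith [hfirst, hyoung, sub_mul (p - 1) ((p - 1) / p) ((|u| * a / (r + ε)) ^ p)]

end PointwiseInequality

/-! ### The integrated inequality and removal of the shift. -/

section AbstractHardy

variable {X : Type*} [MeasurableSpace X] {μ : Measure X} {p : ℝ}

theorem lintegral_shifted_le [IsFiniteMeasure μ] (hp : 1 < p) {ε C : ℝ} (hε : 0 < ε)
    {a r u y D : X → ℝ} (ham : AEStronglyMeasurable a μ) (hrm : AEStronglyMeasurable r μ)
    (hum : AEStronglyMeasurable u μ) (hym : AEStronglyMeasurable y μ)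
    (ha : ∀ x, 0 ≤ a x) (hr : ∀ᵐ x ∂μ, 0 ≤ r x) (hu : ∀ x, |u x| ≤ C)
    (hy : ∀ x, 0 ≤ y x) (hyC : ∀ x, y x ≤ C)
    (hD : ∀ x, |D x| ≤ p * |u x| ^ (p - 1) * y x * a x) (hap : ∫⁻ x, ‖a x‖ₑ ^ p ∂μ ≠ ⊤)
    (hf_int : Integrable (fun x ↦ a x ^ (p - 2) * (shiftedPow p ε (r x) * D x +
      |u x| ^ p * shiftedPowDeriv p ε (r x) * a x ^ 2)) μ)
    (hnonneg : 0 ≤ ∫ x, a x ^ (p - 2) * (shiftedPow p ε (r x) * D x +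
      |u x| ^ p * shiftedPowDeriv p ε (r x) * a x ^ 2) ∂μ) :
    ENNReal.ofReal (((p - 1) / p) ^ p) *
      ∫⁻ x, ‖u x‖ₑ ^ p * (‖a x‖ₑ ^ p / (‖r x‖ₑ + ENNReal.ofReal ε) ^ p) ∂μ ≤
        ∫⁻ x, ‖y x‖ₑ ^ p ∂μ := by
  have hp0 : 0 < p := by linarith
  have hp1 : 0 < p - 1 := by linarith
  set c := (p - 1) / p with hc
  have hc0 : 0 < c := by positivity
  have hXnonneg : ∀ x, 0 ≤ |u x| * a x / (|r x| + ε) := fun x ↦ by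
    have := ha x; positivity
  have hapint : Integrable (fun x ↦ a x ^ p) μ := by
    refine ⟨(ham.aemeasurable.pow_const _).aestronglyMeasurable, ?_⟩
    refine lt_of_eq_of_lt (lintegral_congr fun x ↦ ?_) (lt_top_iff_ne_top.2 hap)
    rw [Real.enorm_rpow_of_nonneg (ha x) hp0.le]
  have hyint : Integrable (fun x ↦ y x ^ p) μ := by
    refine (integrable_const (C ^ p)).mono'
      (hym.aemeasurable.pow_const _).aestronglyMeasurable (Eventually.of_forall fun x ↦ ?_)
    have hyx := hy x
    rw [Real.norm_of_nonneg (by positivity)]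
    exact Real.rpow_le_rpow hyx (hyC x) hp0.le
  -- `r` is nonnegative only almost everywhere; with `|r x|` the denominator is at least `ε`
  -- everywhere.
  have hXint : Integrable (fun x ↦ (|u x| * a x / (|r x| + ε)) ^ p) μ := by
    refine (hapint.const_mul ((C / ε) ^ p)).mono' ?_ (Eventually.of_forall fun x ↦ ?_)
    · exact ((((hum.norm.mul ham).aemeasurable).div
        (hrm.norm.aemeasurable.add_const ε)).pow_const p).aestronglyMeasurable
    · have hax := ha x
      have hC : 0 ≤ C := (abs_nonneg _).trans (hu x)
      rw [Real.norm_of_nonneg (Real.rpow_nonneg (hXnonneg x) p),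
        ← Real.mul_rpow (by positivity) hax]
      refine Real.rpow_le_rpow (hXnonneg x) ?_ hp0.le
      rw [div_mul_eq_mul_div]
      gcongr
      · exact hu x
      · linarith [abs_nonneg (r x)]
  have hmain : c ^ p * ∫ x, (|u x| * a x / (|r x| + ε)) ^ p ∂μ ≤ ∫ x, y x ^ p ∂μ := by
    have hle : 0 ≤ c ^ (1 - p) * ∫ x, y x ^ p ∂μ -
        c * ∫ x, (|u x| * a x / (|r x| + ε)) ^ p ∂μ := by
      rw [← integral_const_mul, ← integral_const_mul,
        ← integral_sub (hyint.const_mul _) (hXint.const_mul _)]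
      refine hnonneg.trans (integral_mono_ae hf_int
        ((hyint.const_mul _).sub (hXint.const_mul _)) ?_)
      filter_upwards [hr] with x hx
      have := hardy_integrand_le hp hε hx (ha x) (hy x) (hD x)
      simpa only [abs_of_nonneg hx] using this
    have hcc : c ^ (p - 1) * c ^ (1 - p) = 1 := by
      rw [← Real.rpow_add hc0]; simp
    have hcp : c ^ p = c ^ (p - 1) * c := by
      rw [← Real.rpow_add_one hc0.ne']; congr 1; ring
    have := mul_nonneg (Real.rpow_nonneg hc0.le (p - 1)) hle
    rw [mul_sub, ← mul_assoc, ← mul_assoc, hcc, ← hcp] at this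
    linarith
  have hL : ∫⁻ x, ‖u x‖ₑ ^ p * (‖a x‖ₑ ^ p / (‖r x‖ₑ + ENNReal.ofReal ε) ^ p) ∂μ =
      ENNReal.ofReal (∫ x, (|u x| * a x / (|r x| + ε)) ^ p ∂μ) := by
    rw [ofReal_integral_eq_lintegral_ofReal hXint
      (Eventually.of_forall fun x ↦ Real.rpow_nonneg (hXnonneg x) p)]
    refine lintegral_congr fun x ↦ ?_
    have hs : 0 < |r x| + ε := by positivity
    rw [Real.enorm_eq_ofReal_abs, Real.enorm_of_nonneg (ha x), Real.enorm_eq_ofReal_abs,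
      ← ENNReal.ofReal_add (abs_nonneg _) hε.le, ← ENNReal.div_rpow_of_nonneg _ _ hp0.le,
      ← ENNReal.mul_rpow_of_nonneg _ _ hp0.le, ← ENNReal.ofReal_div_of_pos hs,
      ← ENNReal.ofReal_mul (abs_nonneg _), ← mul_div_assoc,
      ENNReal.ofReal_rpow_of_nonneg (hXnonneg x) hp0.le]
  have hR : ∫⁻ x, ‖y x‖ₑ ^ p ∂μ = ENNReal.ofReal (∫ x, y x ^ p ∂μ) := by
    rw [ofReal_integral_eq_lintegral_ofReal hyint
      (Eventually.of_forall fun x ↦ Real.rpow_nonneg (hy x) p)]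
    refine lintegral_congr fun x ↦ ?_
    rw [Real.enorm_of_nonneg (hy x), ENNReal.ofReal_rpow_of_nonneg (hy x) hp0.le]
  rw [hL, hR, ← ENNReal.ofReal_mul (by positivity)]
  exact ENNReal.ofReal_le_ofReal hmain

/-- Removal of the shift `ε` in the Hardy inequality. -/
theorem lintegral_le_of_forall_shifted_le (hp : 1 < p) {a r u : X → ℝ} {c B : ℝ≥0∞}
    (hc : c ≠ ⊤) (ham : AEStronglyMeasurable a μ) (hrm : AEStronglyMeasurable r μ)
    (hum : AEStronglyMeasurable u μ)
    (h : ∀ ε : ℝ, 0 < ε →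
      c * ∫⁻ x, ‖u x‖ₑ ^ p * (‖a x‖ₑ ^ p / (‖r x‖ₑ + ENNReal.ofReal ε) ^ p) ∂μ ≤ B) :
    c * ∫⁻ x, ‖u x‖ₑ ^ p * (‖a x‖ₑ ^ p / ‖r x‖ₑ ^ p) ∂μ ≤ B := by
  have hp0 : 0 < p := by linarith
  let ε : ℕ → ℝ := fun m ↦ 1 / ((m : ℝ) + 1)
  have hε : Tendsto (fun m ↦ ENNReal.ofReal (ε m)) atTop (𝓝 0) := by
    have := ENNReal.tendsto_ofReal (tendsto_one_div_add_atTop_nhds_zero_nat (𝕜 := ℝ))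
    rwa [ENNReal.ofReal_zero] at this
  have hfin : ∀ t : ℝ, ‖t‖ₑ ^ p ≠ ⊤ := fun t ↦ ENNReal.rpow_ne_top_of_nonneg hp0.le enorm_ne_top
  let F : ℕ → X → ℝ≥0∞ := fun m x ↦
    c * (‖u x‖ₑ ^ p * (‖a x‖ₑ ^ p / (‖r x‖ₑ + ENNReal.ofReal (ε m)) ^ p))
  have hF : ∀ x, Tendsto (fun m ↦ F m x) atTop
      (𝓝 (c * (‖u x‖ₑ ^ p * (‖a x‖ₑ ^ p / ‖r x‖ₑ ^ p)))) := fun x ↦ by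
    have h1 : Tendsto (fun m ↦ ‖r x‖ₑ + ENNReal.ofReal (ε m)) atTop (𝓝 (‖r x‖ₑ)) := by
      simpa using hε.const_add (‖r x‖ₑ)
    -- Inversion is continuous on `[0, ∞]`, so this holds also where `r x = 0`. The outer factors
    -- are finite, so the products converge, with `0 * ∞ = 0` in the limit.
    have h2 := tendsto_inv_iff.2 (h1.ennrpow_const p)
    exact ENNReal.Tendsto.const_mul (ENNReal.Tendsto.const_mul
      (ENNReal.Tendsto.const_mul h2 (Or.inr (hfin _))) (Or.inr (hfin _))) (Or.inr hc)
  have hFm : ∀ m, AEMeasurable (F m) μ := fun m ↦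
    ((hum.enorm.pow_const p).mul ((ham.enorm.pow_const p).div
      ((hrm.enorm.add_const _).pow_const p))).const_mul c
  calc c * ∫⁻ x, ‖u x‖ₑ ^ p * (‖a x‖ₑ ^ p / ‖r x‖ₑ ^ p) ∂μ
      = ∫⁻ x, liminf (fun m ↦ F m x) atTop ∂μ := by
        rw [← lintegral_const_mul' _ _ hc]
        exact lintegral_congr fun x ↦ (hF x).liminf_eq.symm
    _ ≤ liminf (fun m ↦ ∫⁻ x, F m x ∂μ) atTop := lintegral_liminf_le' hFm
    _ ≤ B := by
        refine liminf_le_of_frequently_le' (Frequently.of_forall fun m ↦ ?_)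
        rw [lintegral_const_mul' _ _ hc]
        exact h (ε m) (by positivity)

end AbstractHardy

/-! ### The Hardy inequality on the manifold. -/

section Hardy

variable {n : ℕ} {M : Type*} [TopologicalSpace M] [ChartedSpace (EuclideanSpace ℝ (Fin n)) M]
  [RiemannianBundle (fun x : M ↦ TangentSpace (𝓡 n) x)]
  {p : ℝ} {Ω : Set M} {ρ : M → ℝ} {V : ∀ x : M, TangentSpace (𝓡 n) x}

theorem inner_grad_test (hp : 1 < p) {ε : ℝ} (hε : 0 < ε) {u φ : M → ℝ}
    (hu : ContMDiff (𝓡 n) 𝓘(ℝ, ℝ) 1 u) (hφ : ContMDiff (𝓡 n) 𝓘(ℝ, ℝ) 1 φ) (x : M)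
    (v : TangentSpace (𝓡 n) x) :
    inner ℝ v (grad (fun y ↦ |u y| ^ p * shiftedPow p ε (φ y)) x) =
      shiftedPow p ε (φ x) * (p * |u x| ^ (p - 2) * u x * differential u x v) +
        |u x| ^ p * shiftedPowDeriv p ε (φ x) * differential φ x v := by
  have hux : MDifferentiableAt (𝓡 n) 𝓘(ℝ, ℝ) u x := hu.mdifferentiableAt one_ne_zero
  have hφx : MDifferentiableAt (𝓡 n) 𝓘(ℝ, ℝ) φ x := hφ.mdifferentiableAt one_ne_zero
  have h1 : MDifferentiableAt (𝓡 n) 𝓘(ℝ, ℝ) (fun y ↦ |u y| ^ p) x :=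
    (hasDerivAt_abs_rpow (u x) hp).differentiableAt.mdifferentiableAt.comp x hux
  have h2 : MDifferentiableAt (𝓡 n) 𝓘(ℝ, ℝ) (fun y ↦ shiftedPow p ε (φ y)) x :=
    (hasDerivAt_shiftedPow p hε (φ x)).differentiableAt.mdifferentiableAt.comp x hφx
  rw [inner_grad, differential_mul h1 h2, differential_comp (hasDerivAt_abs_rpow (u x) hp) hux,
    differential_comp (hasDerivAt_shiftedPow p hε (φ x)) hφx]
  change |u x| ^ p * (shiftedPowDeriv p ε (φ x) * differential φ x v) + shiftedPow p ε (φ x) *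
    (p * |u x| ^ (p - 2) * u x * differential u x v) = _
  ring

variable [MeasurableSpace M]

/-- The weak inequality tested with `|u| ^ p * shiftedPow p ε φ`. -/
theorem IsWeaklyPSuperharmonicOn.test_nonneg [OpensMeasurableSpace M]
    (hsuper : IsWeaklyPSuperharmonicOn p Ω V)
    (hp : 1 < p) {ε : ℝ} (hε : 0 < ε) (hΩ : IsOpen Ω) {U : Set M} (hUΩ : U ⊆ Ω) {u φ : M → ℝ}
    (hu : ContMDiff (𝓡 n) 𝓘(ℝ, ℝ) 1 u) (huc : HasCompactSupport u) (huU : tsupport u ⊆ U)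
    (hφ : ContMDiff (𝓡 n) 𝓘(ℝ, ℝ) 1 φ) :
    0 ≤ ∫ x in U, ‖V x‖ ^ (p - 2) *
      (shiftedPow p ε (φ x) * (p * |u x| ^ (p - 2) * u x * differential u x (V x)) +
        |u x| ^ p * shiftedPowDeriv p ε (φ x) * differential φ x (V x))
          ∂(riemannianVolume n M) := by
  have hp0 : p ≠ 0 := by linarith
  have hsupp : tsupport (fun y ↦ |u y| ^ p * shiftedPow p ε (φ y)) ⊆ tsupport u := by
    refine closure_mono fun x hx ↦ ?_
    contrapose! hx
    simp [Function.notMem_support.1 hx, Real.zero_rpow hp0]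
  have h := hsuper (fun y ↦ |u y| ^ p * shiftedPow p ε (φ y)) ?_
    (huc.of_isClosed_subset (isClosed_tsupport _) hsupp) (hsupp.trans (huU.trans hUΩ))
    (fun x ↦ mul_nonneg (by positivity) (shiftedPow_pos hp hε _).le)
  · simp only [inner_grad_test hp hε hu hφ] at h
    rwa [setIntegral_eq_of_subset_of_forall_sdiff_eq_zero hΩ.measurableSet hUΩ] at h
    intro x hx
    have hux : u x = 0 := image_eq_zero_of_notMem_tsupport fun h ↦ hx.2 (huU h)
    simp [hux, Real.zero_rpow hp0]
  -- `|t| ^ p` is `C^1` for `1 < p` but in general not smooth, so the `C^1` test class is needed.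
  · exact (((contDiff_norm_rpow (E := ℝ) hp).comp_contMDiff hu)).mul
      ((contDiff_shiftedPow p hε).comp_contMDiff hφ)

variable [IsManifold (𝓡 n) ∞ M]

/-- The image of a weak gradient under a continuous function on the tangent bundle is measurable. -/
theorem HasSobolevGradOn.aestronglyMeasurable_comp {U : Set M} (h : HasSobolevGradOn p U ρ V)
    {F : TangentBundle (𝓡 n) M → ℝ} (hF : Continuous F) :
    AEStronglyMeasurable (fun x ↦ F ⟨x, V x⟩) ((riemannianVolume n M).restrict U) :=
  hF.comp_aestronglyMeasurable h.aestronglyMeasurable_grad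

variable [T2Space M] [BorelSpace M]

/-- Near a compact subset of `Ω`, a function in `W^{1,p}_loc(Ω)` is approximated by functions that
are smooth on the whole manifold. -/
theorem HasLocSobolevGradOn.exists_contMDiff_approx
    [SecondCountableTopology M] (hρ : HasLocSobolevGradOn p Ω ρ V)
    (hΩ : IsOpen Ω) {K : Set M} (hK : IsCompact K) (hKΩ : K ⊆ Ω) :
    ∃ U : Set M, IsOpen U ∧ K ⊆ U ∧ IsCompact (closure U) ∧ closure U ⊆ Ω ∧
      ∃ φ : ℕ → M → ℝ, (∀ k, ContMDiff (𝓡 n) 𝓘(ℝ, ℝ) ∞ (φ k)) ∧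
        Tendsto (fun k ↦ ∫⁻ x in U, ‖φ k x - ρ x‖ₑ ^ p ∂(riemannianVolume n M)) atTop (𝓝 0) ∧
        Tendsto (fun k ↦ ∫⁻ x in U, ‖grad (φ k) x - V x‖ₑ ^ p ∂(riemannianVolume n M))
          atTop (𝓝 0) := by
  have : LocallyCompactSpace M := ChartedSpace.locallyCompactSpace (EuclideanSpace ℝ (Fin n)) M
  -- Nested neighbourhoods of `K`: the approximations live on `W`, and a cutoff equal to `1` near
  -- `closure U` and `0` off `closure T` extends them by zero without changing values or gradients
  -- on `U`.
  obtain ⟨W, hW, hKW, hWΩ, hWc⟩ := exists_open_between_and_isCompact_closure hK hΩ hKΩ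
  obtain ⟨T, hT, hKT, hTW, hTc⟩ := exists_open_between_and_isCompact_closure hK hW hKW
  obtain ⟨U, hU, hKU, hUT, hUc⟩ := exists_open_between_and_isCompact_closure hK hT hKT
  obtain ⟨χ, hχ1, hχ0, -⟩ := exists_contMDiffMap_one_nhds_of_subset_interior (𝓡 n) (n := ⊤)
    (s := closure U) (t := closure T) isClosed_closure
    (hUT.trans (interior_maximal subset_closure hT))
  obtain ⟨φ, hφ, -, -, hφρ, hφV⟩ := (hρ W hW hWc hWΩ).exists_approx
  have hUW : U ⊆ W := subset_closure.trans (hUT.trans (subset_closure.trans hTW))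
  have heq : ∀ k, ∀ x ∈ U, (fun y ↦ χ y * φ k y) =ᶠ[𝓝 x] φ k := fun k x hx ↦ by
    filter_upwards [hχ1.filter_mono (nhds_le_nhdsSet (subset_closure hx))] with y hy
    rw [hy, one_mul]
  refine ⟨U, hU, hKU, hUc, (hUT.trans (subset_closure.trans (hTW.trans subset_closure))).trans hWΩ,
    fun k y ↦ χ y * φ k y, fun k x ↦ ?_, ?_, ?_⟩
  · by_cases hx : x ∈ W
    · exact χ.contMDiff.contMDiffAt.mul ((hφ k).contMDiffAt (hW.mem_nhds hx))
    · have hz : (fun y ↦ χ y * φ k y) =ᶠ[𝓝 x] fun _ ↦ (0 : ℝ) := by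
        filter_upwards [isClosed_closure.isOpen_compl.mem_nhds
          (fun h ↦ hx (hTW h) : x ∈ (closure T)ᶜ)] with y hy
        rw [hχ0 y hy, zero_mul]
      exact contMDiffAt_const.congr_of_eventuallyEq hz
  · refine tendsto_of_tendsto_of_tendsto_of_le_of_le tendsto_const_nhds hφρ
      (fun k ↦ zero_le) fun k ↦ ?_
    refine le_of_eq_of_le (setLIntegral_congr_fun hU.measurableSet fun x hx ↦ ?_)
      (lintegral_mono_set hUW)
    exact congrArg (fun t ↦ ‖t - ρ x‖ₑ ^ p) (heq k x hx).eq_of_nhds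
  · refine tendsto_of_tendsto_of_tendsto_of_le_of_le tendsto_const_nhds hφV
      (fun k ↦ zero_le) fun k ↦ ?_
    refine le_of_eq_of_le (setLIntegral_congr_fun hU.measurableSet fun x hx ↦ ?_)
      (lintegral_mono_set hUW)
    change ‖grad (fun y ↦ χ y * φ k y) x - V x‖ₑ ^ p = _
    rw [grad_congr (heq k x hx)]

variable [IsContMDiffRiemannianBundle (𝓡 n) ∞ (EuclideanSpace ℝ (Fin n))
  (fun x : M ↦ TangentSpace (𝓡 n) x)]

/-- The gradient of a `C^1` function is `p`-integrable on relatively compact sets. -/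
theorem lintegral_grad_rpow_lt_top (hp : 0 ≤ p) {u : M → ℝ}
    (hu : ContMDiff (𝓡 n) 𝓘(ℝ, ℝ) 1 u) {K : Set M} (hK : IsCompact K) :
    ∫⁻ x in K, ‖grad (n := n) u x‖ₑ ^ p ∂(riemannianVolume n M) < ⊤ := by
  obtain ⟨C, hC⟩ := hK.exists_bound_of_continuousOn (continuous_norm_grad hu).continuousOn
  calc ∫⁻ x in K, ‖grad (n := n) u x‖ₑ ^ p ∂(riemannianVolume n M)
      ≤ ∫⁻ x in K, ENNReal.ofReal C ^ p ∂(riemannianVolume n M) := by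
        refine setLIntegral_mono' hK.measurableSet fun x hx ↦ ?_
        gcongr
        rw [← enorm_norm, Real.enorm_eq_ofReal_abs]
        exact ENNReal.ofReal_le_ofReal (hC x hx)
    _ < ⊤ := by
        rw [setLIntegral_const]
        exact ENNReal.mul_lt_top (ENNReal.rpow_lt_top_of_nonneg hp ENNReal.ofReal_ne_top)
          hK.measure_lt_top

/-- The weak gradient of a function in `W^{1,p}` is in `L^p`. -/
theorem lintegral_weakGrad_rpow_ne_top (hp : 1 < p) {U : Set M} (hUc : IsCompact (closure U))
    {φ : ℕ → M → ℝ} (hφ : ∀ k, ContMDiff (𝓡 n) 𝓘(ℝ, ℝ) ∞ (φ k))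
    (hφV : Tendsto (fun k ↦ ∫⁻ x in U, ‖grad (φ k) x - V x‖ₑ ^ p ∂(riemannianVolume n M))
      atTop (𝓝 0)) :
    ∫⁻ x in U, ‖V x‖ₑ ^ p ∂(riemannianVolume n M) ≠ ⊤ := by
  obtain ⟨k, hk⟩ := (hφV.eventually_lt_const ENNReal.zero_lt_top).exists
  have hφ1 : ContMDiff (𝓡 n) 𝓘(ℝ, ℝ) 1 (φ k) := (hφ k).of_le (by simp)
  have hg : ∫⁻ x in U, ‖grad (n := n) (φ k) x‖ₑ ^ p ∂(riemannianVolume n M) < ⊤ :=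
    (lintegral_mono_set subset_closure).trans_lt
      (lintegral_grad_rpow_lt_top (by linarith) hφ1 hUc)
  have hgm : Measurable fun x ↦ ‖grad (n := n) (φ k) x‖ₑ ^ p := by
    simp only [← enorm_norm (grad (n := n) (φ k) _)]
    exact (continuous_norm_grad hφ1).measurable.enorm.pow_const p
  refine ne_top_of_le_ne_top ?_ (lintegral_mono fun x ↦ ?_ :
    _ ≤ ∫⁻ x in U, 2 ^ (p - 1) * (‖grad (n := n) (φ k) x‖ₑ ^ p + ‖grad (φ k) x - V x‖ₑ ^ p)
      ∂(riemannianVolume n M))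
  · rw [lintegral_const_mul' _ _ (by simp), lintegral_add_left hgm]
    exact ENNReal.mul_ne_top (by simp) (ENNReal.add_lt_top.2 ⟨hg, hk⟩).ne
  · refine le_trans ?_ (ENNReal.rpow_add_le_mul_rpow_add_rpow _ _ hp.le)
    gcongr
    calc ‖V x‖ₑ = ‖grad (φ k) x - (grad (φ k) x - V x)‖ₑ := by rw [sub_sub_cancel]
      _ ≤ _ := enorm_sub_le

variable [SecondCountableTopology M]

/-- The Hardy inequality for a weakly `p`-superharmonic weight. -/
theorem hardy_inequality (hp : 1 < p) (hΩ : IsOpen Ω) (hρ : HasLocSobolevGradOn p Ω ρ V)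
    (hρ_nonneg : ∀ᵐ x ∂((riemannianVolume n M).restrict Ω), 0 ≤ ρ x)
    (hρ_super : IsWeaklyPSuperharmonicOn p Ω V) {u : M → ℝ}
    (hu : ContMDiff (𝓡 n) 𝓘(ℝ, ℝ) ∞ u) (huc : HasCompactSupport u) (huΩ : tsupport u ⊆ Ω) :
    ENNReal.ofReal (((p - 1) / p) ^ p) *
        ∫⁻ x in Ω, ‖u x‖ₑ ^ p * (‖V x‖ₑ ^ p / ‖ρ x‖ₑ ^ p) ∂(riemannianVolume n M) ≤
      ∫⁻ x in Ω, ‖grad (n := n) u x‖ₑ ^ p ∂(riemannianVolume n M) := by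
  have hp0 : 0 < p := by linarith
  obtain ⟨U, hU, huU, hUc, hUΩ, φ, hφ, hφρ, hφV⟩ := hρ.exists_contMDiff_approx hΩ huc huΩ
  have hU_sub : U ⊆ Ω := subset_closure.trans hUΩ
  have hS := hρ U hU hUc hUΩ
  have hfin : IsFiniteMeasure ((riemannianVolume n M).restrict U) :=
    isFiniteMeasure_restrict.2 ((measure_mono subset_closure).trans_lt hUc.measure_lt_top).ne
  have hu1 : ContMDiff (𝓡 n) 𝓘(ℝ, ℝ) 1 u := hu.of_le (by simp)
  have hφ1 : ∀ k, ContMDiff (𝓡 n) 𝓘(ℝ, ℝ) 1 (φ k) := fun k ↦ (hφ k).of_le (by simp)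
  have hVm : AEStronglyMeasurable (fun x ↦ ‖V x‖) ((riemannianVolume n M).restrict U) :=
    hS.aestronglyMeasurable_comp continuous_norm_tangentBundle
  have hdiff : ∀ {w : M → ℝ}, ContMDiff (𝓡 n) 𝓘(ℝ, ℝ) 1 w →
      AEStronglyMeasurable (fun x ↦ differential w x (V x))
        ((riemannianVolume n M).restrict U) := fun hw ↦
    hS.aestronglyMeasurable_comp (continuous_differential_apply hw)
  have hdm : ∀ k, AEStronglyMeasurable (fun x ↦ ‖grad (φ k) x - V x‖)
      ((riemannianVolume n M).restrict U) := fun k ↦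
    hS.aestronglyMeasurable_comp (continuous_norm_grad_sub (hφ1 k))
  have hgrad_le : ∀ (w : M → ℝ) (x : M),
      |differential w x (V x)| ≤ ‖grad (n := n) w x‖ * ‖V x‖ := fun w x ↦ by
    rw [← inner_grad, mul_comm]
    exact abs_real_inner_le_norm _ _
  have hgc := continuous_norm_grad hu1
  have hgsupp : HasCompactSupport fun x ↦ ‖grad (n := n) u x‖ :=
    HasCompactSupport.intro huc fun x hx ↦ by
      rw [grad_eq_zero_of_notMem_tsupport hx, norm_zero]
  obtain ⟨C₁, hC₁⟩ := huc.exists_bound_of_continuous hu1.continuous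
  obtain ⟨C₂, hC₂⟩ := hgsupp.exists_bound_of_continuous hgc
  have hap := lintegral_weakGrad_rpow_ne_top hp hUc hφ hφV
  have hρU : ∀ᵐ x ∂((riemannianVolume n M).restrict U), 0 ≤ ρ x :=
    ae_mono (Measure.restrict_mono_set _ hU_sub) hρ_nonneg
  have hum : AEStronglyMeasurable u ((riemannianVolume n M).restrict U) :=
    hu1.continuous.aestronglyMeasurable
  have hap' : ∫⁻ x in U, ‖‖V x‖‖ₑ ^ p ∂(riemannianVolume n M) ≠ ⊤ := by
    simpa only [enorm_norm] using hap
  have hD : ∀ x, |p * |u x| ^ (p - 2) * u x * differential u x (V x)| ≤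
      p * |u x| ^ (p - 1) * ‖grad (n := n) u x‖ * ‖V x‖ := fun x ↦ by
    rw [abs_mul, abs_mul, abs_mul, abs_of_pos hp0,
      abs_of_nonneg (Real.rpow_nonneg (abs_nonneg (u x)) _), mul_assoc p,
      rpow_sub_two_mul_self hp (abs_nonneg _), mul_assoc (p * _)]
    gcongr
    exact hgrad_le u x
  -- One constant bounding `|u|`, `|∇u|`, `|u|^p` and `p |u|^(p-1) |∇u|`.
  set C := max (max C₁ C₂) (max (C₁ ^ p) (p * C₁ ^ (p - 1) * C₂))
  have hshift : ∀ ε : ℝ, 0 < ε → ENNReal.ofReal (((p - 1) / p) ^ p) *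
      ∫⁻ x in U, ‖u x‖ₑ ^ p * (‖‖V x‖‖ₑ ^ p / (‖ρ x‖ₑ + ENNReal.ofReal ε) ^ p)
        ∂(riemannianVolume n M) ≤
      ∫⁻ x in U, ‖‖grad (n := n) u x‖‖ₑ ^ p ∂(riemannianVolume n M) := fun ε hε ↦ by
    have hlim := integral_nonneg_of_tendsto (μ := (riemannianVolume n M).restrict U) (C := C)
      hp hε (a := fun x ↦ ‖V x‖) (r := ρ)
      (D := fun x ↦ p * |u x| ^ (p - 2) * u x * differential u x (V x))
      (U := fun x ↦ |u x| ^ p) (rk := φ) (bk := fun k x ↦ differential (φ k) x (V x))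
      (dk := fun k x ↦ ‖grad (φ k) x - V x‖) hVm hS.aestronglyMeasurable
      (((((hum.norm.aemeasurable.pow_const (p - 2)).const_mul p).mul
        hum.aemeasurable).aestronglyMeasurable).mul (hdiff hu1))
      (hum.norm.aemeasurable.pow_const p).aestronglyMeasurable
      (fun k ↦ (hφ1 k).continuous.aestronglyMeasurable) (fun k ↦ hdiff (hφ1 k))
      hdm (fun x ↦ norm_nonneg _) hρU (fun x ↦ (hD x).trans ?_) (fun x ↦ ?_) (fun k x ↦ ?_) hap' hφρ
      (by simpa only [enorm_norm] using hφV)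
      (fun k ↦ hρ_super.test_nonneg hp hε hΩ hU_sub hu1 huc huU (hφ1 k))
    · exact lintegral_shifted_le (C := C) hp hε hVm hS.aestronglyMeasurable hum
        hgc.aestronglyMeasurable (fun x ↦ norm_nonneg _) hρU
        (fun x ↦ (hC₁ x).trans (le_max_of_le_left (le_max_left _ _))) (fun x ↦ norm_nonneg _)
        (fun x ↦ (le_abs_self _).trans ((hC₂ x).trans (le_max_of_le_left (le_max_right _ _))))
        hD hap' hlim.1 hlim.2
    · gcongr
      refine le_trans ?_ (le_max_of_le_right (le_max_right _ _))
      have h2 : ‖grad (n := n) u x‖ ≤ C₂ := (le_abs_self _).trans (hC₂ x)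
      have h1 : |u x| ≤ C₁ := hC₁ x
      have hC₁0 : 0 ≤ C₁ := (abs_nonneg _).trans h1
      have : 0 ≤ p - 1 := by linarith
      gcongr
    · rw [abs_of_nonneg (by positivity)]
      exact (Real.rpow_le_rpow (abs_nonneg _) (hC₁ x) hp0.le).trans
        (le_max_of_le_right (le_max_left _ _))
    · rw [← inner_grad, ← real_inner_self_eq_norm_sq, ← inner_sub_right, mul_comm]
      exact abs_real_inner_le_norm _ _
  have hlimit := lintegral_le_of_forall_shifted_le hp ENNReal.ofReal_ne_top hVm
    hS.aestronglyMeasurable hum hshift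
  simp only [enorm_norm] at hlimit
  calc _ ≤ ENNReal.ofReal (((p - 1) / p) ^ p) *
        ∫⁻ x in U, ‖u x‖ₑ ^ p * (‖V x‖ₑ ^ p / ‖ρ x‖ₑ ^ p) ∂(riemannianVolume n M) := by
        refine mul_le_mul' le_rfl ?_
        rw [← lintegral_indicator hU.measurableSet]
        refine (setLIntegral_le_lintegral _ _).trans (lintegral_mono fun x ↦ ?_)
        by_cases hx : x ∈ U
        · rw [indicator_of_mem hx]
        -- Off `U` the integrand is zero even where the weight is infinite.
        · have hux : u x = 0 := image_eq_zero_of_notMem_tsupport fun h ↦ hx (huU h)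
          simp [hux, hp0]
    _ ≤ ∫⁻ x in U, ‖grad (n := n) u x‖ₑ ^ p ∂(riemannianVolume n M) := hlimit
    _ ≤ _ := lintegral_mono_set hU_sub

/-- The Hardy weight is locally integrable. -/
theorem locallyIntegrableOn_hardyWeight (hp : 1 < p) (hΩ : IsOpen Ω)
    (hρ : HasLocSobolevGradOn p Ω ρ V)
    (hρ_nonneg : ∀ᵐ x ∂((riemannianVolume n M).restrict Ω), 0 ≤ ρ x)
    (hρ_super : IsWeaklyPSuperharmonicOn p Ω V) :
    LocallyIntegrableOn (fun x ↦ ‖V x‖ₑ ^ p / ‖ρ x‖ₑ ^ p) Ω (riemannianVolume n M) := by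
  intro x hx
  have hp0 : 0 < p := by linarith
  have hc0 : 0 < ((p - 1) / p) ^ p := by have : 0 < p - 1 := by linarith
                                         positivity
  have : LocallyCompactSpace M := ChartedSpace.locallyCompactSpace (EuclideanSpace ℝ (Fin n)) M
  obtain ⟨U, hU, hxU, hUΩ, hUc⟩ := exists_open_between_and_isCompact_closure
    (isCompact_singleton (x := x)) hΩ (singleton_subset_iff.2 hx)
  -- A bump function equal to `1` on `s`: the integral of the weight over `U ∩ s` is at most the one
  -- in the Hardy inequality for `f`.
  obtain ⟨f, -, hf⟩ := (SmoothBumpFunction.nhds_basis_tsupport (I := 𝓡 n) x).mem_iff.1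
    (hU.mem_nhds (hxU rfl))
  obtain ⟨s, hs1, hs, hxs⟩ := eventually_nhds_iff.1 f.eventuallyEq_one
  have hS := hρ U hU hUc hUΩ
  refine ⟨U ∩ s, mem_nhdsWithin_of_mem_nhds ((hU.inter hs).mem_nhds ⟨hxU rfl, hxs⟩), ?_, ?_⟩
  · refine AEStronglyMeasurable.mono_measure ?_ (Measure.restrict_mono_set _ inter_subset_left)
    have hVm := (hS.aestronglyMeasurable_comp continuous_norm_tangentBundle).enorm
    simp only [enorm_norm] at hVm
    exact ((hVm.pow_const p).div
      (hS.aestronglyMeasurable.enorm.pow_const p)).aestronglyMeasurable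
  · have hfc : HasCompactSupport f := f.hasCompactSupport
    have hfΩ : tsupport f ⊆ Ω := hf.trans (subset_closure.trans hUΩ)
    have hardy := hardy_inequality hp hΩ hρ hρ_nonneg hρ_super f.contMDiff hfc hfΩ
    have hgrad : ∫⁻ y in Ω, ‖grad (n := n) f y‖ₑ ^ p ∂(riemannianVolume n M) < ⊤ := by
      refine lt_of_le_of_lt ?_ (lintegral_grad_rpow_lt_top hp0.le
        (f.contMDiff.of_le (by simp)) hfc)
      rw [← lintegral_indicator (isClosed_tsupport _).measurableSet]
      refine (setLIntegral_le_lintegral _ _).trans (lintegral_mono fun y ↦ ?_)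
      by_cases hy : y ∈ tsupport f
      · rw [indicator_of_mem hy]
      · simp [grad_eq_zero_of_notMem_tsupport hy, hp0]
    have hfinite : ∫⁻ y in Ω, ‖f y‖ₑ ^ p * (‖V y‖ₑ ^ p / ‖ρ y‖ₑ ^ p)
        ∂(riemannianVolume n M) < ⊤ := by
      refine lt_of_not_ge fun h ↦ ?_
      -- The Hardy constant is positive, so an infinite integral would force `∫ |∇f|^p = ∞`.
      rw [top_le_iff.1 h, ENNReal.mul_top (by simpa using hc0)] at hardy
      exact absurd (top_le_iff.1 hardy) hgrad.ne
    refine lt_of_le_of_lt ?_ hfinite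
    refine le_trans ?_ (lintegral_mono_set
      (inter_subset_left.trans (subset_closure.trans hUΩ) : U ∩ s ⊆ Ω))
    refine setLIntegral_mono' (hU.inter hs).measurableSet fun y hy ↦ ?_
    simp [hs1 y hy.2]

end Hardy

end RiemannianHardy

/-- `ρ ∈ W^{1,p}_loc(Ω)` has weak gradient `V = ∇ρ`. The quotient `|∇ρ|^p / ρ^p` takes values in
`[0, ∞]`, with `0 / 0 = 0` and `a / 0 = ∞` for `a > 0`. -/
theorem mainTheorem1 {n : ℕ} {M : Type*} [TopologicalSpace M] [T2Space M]
    [SecondCountableTopology M] [ChartedSpace (EuclideanSpace ℝ (Fin n)) M]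
    [IsManifold (𝓡 n) ∞ M] [RiemannianBundle (fun x : M ↦ TangentSpace (𝓡 n) x)]
    [IsContMDiffRiemannianBundle (𝓡 n) ∞ (EuclideanSpace ℝ (Fin n))
      (fun x : M ↦ TangentSpace (𝓡 n) x)]
    [MeasurableSpace M] [BorelSpace M]
    (p : ℝ) (hp : 1 < p) (Ω : Set M) (hΩ : IsOpen Ω)
    (ρ : M → ℝ) (V : ∀ x : M, TangentSpace (𝓡 n) x)
    (hρ : RiemannianHardy.HasLocSobolevGradOn p Ω ρ V)
    (hρ_nonneg : ∀ᵐ x ∂((RiemannianHardy.riemannianVolume n M).restrict Ω), 0 ≤ ρ x)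
    (hρ_super : RiemannianHardy.IsWeaklyPSuperharmonicOn p Ω V) :
    LocallyIntegrableOn (fun x ↦ ‖V x‖ₑ ^ p / ‖ρ x‖ₑ ^ p) Ω
        (RiemannianHardy.riemannianVolume n M) ∧
      ∀ u : M → ℝ, ContMDiff (𝓡 n) 𝓘(ℝ, ℝ) ∞ u → HasCompactSupport u → tsupport u ⊆ Ω →
        ENNReal.ofReal (((p - 1) / p) ^ p) *
            ∫⁻ x in Ω, ‖u x‖ₑ ^ p * (‖V x‖ₑ ^ p / ‖ρ x‖ₑ ^ p)
              ∂(RiemannianHardy.riemannianVolume n M) ≤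
          ∫⁻ x in Ω, ‖RiemannianHardy.grad (n := n) u x‖ₑ ^ p
            ∂(RiemannianHardy.riemannianVolume n M) :=
  ⟨RiemannianHardy.locallyIntegrableOn_hardyWeight hp hΩ hρ hρ_nonneg hρ_super,
    fun _ hu huc huΩ ↦
      RiemannianHardy.hardy_inequality hp hΩ hρ hρ_nonneg hρ_super hu huc huΩ⟩
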